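/- Let $f\in C^2([0,\infty))$ be nondecreasing and convex with $f>0$ on $(0,\infty)$. For $u>0$ let $q(u)=\dfrac{f'(u)^2}{f(u)f''(u)}$ if $f(u)f''(u)\neq 0$ and $q(u)=+\infty$ otherwise. Assume that the limit $q_0=\lim_{u\to0^+}q(u)$ exists and that $0<q_0<+\infty$ (the condition $q_0>0$ is automatic when $f(0)=0$). Let $p_0$ be the conjugate exponent, $\frac1{p_0}+\frac1{q_0}=1$ (so $p_0=+\infty$ if $q_0=1$), and for $N\ge 11$ let $$p_c(N)=\frac{(N-2)^2-4N+8\sqrt{N-1}}{(N-2)(N-10)}.$$ Suppose that one of the following holds: (1) $1\le N\le 9$; (2) $N=10$ and $p_0<+\infty$; (3) $N\ge 11$ and $p_0<p_c(N)$. Then there is no bounded function $u\in C^2(\mathbb R^N)$, $u>0$, with $-\Delta u\le f(u)$ in $\mathbb R^N$ which is stable, i.e. satisfies $$\int_{\mathbb R^N}f'(u)\varphi^2\,dx\le\int_{\mathbb R^N}|\nabla\varphi|^2\,dx\qquad\text{for all }\varphi\in C^1_c(\mathbb R^N).$$ Likewise, there is no bounded locally Lipschitz function $u>0$ on $\mathbb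 R^N$ which is stable in this sense and satisfies $-\Delta u\le f(u)$ weakly, i.e. $\int_{\mathbb R^N}\nabla u\cdot\nabla\varphi\,dx\le\int_{\mathbb R^N}f(u)\varphi\,dx$ for all Lipschitz functions $\varphi\ge0$ with compact support. -/

import Mathlib

open Filter Topology MeasureTheory

noncomputable section

namespace StableLiouville

/-- The Euclidean space `ℝ^N`. -/
abbrev Space (N : ℕ) : Type := EuclideanSpace ℝ (Fin N)

/-- The function `q(u) = f'(u)² / (f(u) f''(u))` for `u > 0`, with `q(u) = +∞` when
`f(u) f''(u) = 0`. -/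
def q (f : ℝ → ℝ) (u : ℝ) : EReal :=
  if f u * deriv (deriv f) u ≠ 0 then
    (((deriv f u) ^ 2 / (f u * deriv (deriv f) u) : ℝ) : EReal)
  else ⊤

/-- The conjugate exponent `p` of `q`, i.e. the solution of `1/p + 1/q = 1`: it is `+∞` for
`q = 1`, it is `1` for `q = +∞`, and it is `q / (q - 1)` for every other real `q ≠ 0`. -/
def conjExponent (q : EReal) : EReal :=
  if q = 1 then ⊤
  else if q = ⊤ then 1
  else ((q.toReal / (q.toReal - 1) : ℝ) : EReal)

/-- The Joseph-Lundgren exponent (used for `N ≥ 11`). -/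
def pc (N : ℕ) : ℝ :=
  (((N : ℝ) - 2) ^ 2 - 4 * N + 8 * √((N : ℝ) - 1)) / (((N : ℝ) - 2) * ((N : ℝ) - 10))

/-- Stability: `∫ f'(u) φ² ≤ ∫ |∇φ|²` for all `φ ∈ C¹_c(ℝ^N)`. -/
def IsStable {N : ℕ} (f : ℝ → ℝ) (u : Space N → ℝ) : Prop :=
  ∀ φ : Space N → ℝ, ContDiff ℝ 1 φ → HasCompactSupport φ →
    ∫ x, deriv f (u x) * φ x ^ 2 ≤ ∫ x, ‖gradient φ x‖ ^ 2

/-- `-Δu ≤ f(u)` pointwise on `ℝ^N`, for `u` of class `C²`. -/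
def IsClassicalSubsolution {N : ℕ} (f : ℝ → ℝ) (u : Space N → ℝ) : Prop :=
  ContDiff ℝ 2 u ∧ ∀ x, -(Laplacian.laplacian u x) ≤ f (u x)

/-- `-Δu ≤ f(u)` weakly on `ℝ^N`, for `u` locally Lipschitz: `∫ ∇u·∇φ ≤ ∫ f(u) φ` for all
Lipschitz `φ ≥ 0` with compact support (the gradients exist almost everywhere). -/
def IsWeakSubsolution {N : ℕ} (f : ℝ → ℝ) (u : Space N → ℝ) : Prop :=
  LocallyLipschitz u ∧
    ∀ φ : Space N → ℝ, (∃ K, LipschitzWith K φ) → HasCompactSupport φ → (∀ x, 0 ≤ φ x) →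
      ∫ x, inner ℝ (gradient u x) (gradient φ x) ≤ ∫ x, f (u x) * φ x

end StableLiouville

end

/-! Stability is tested with `φ(u) η` and the differential inequality with `ψ(u) η²`, where `ψ' ≥
φ'²`. If `f ψ ≤ (1 - c) f' φ²` with `c > 0`, the two combine into `∫ f'(u) φ(u)² η² ≤ C ∫ φ(u)²
|∇η|²` (`energy_estimate`).

Suppose `f(0) = 0`; convexity then forces `q₀ ≥ 1` (`not_deriv_sq_le`). Near `0` take `φ = f^a` and
`ψ = κ f^(2a-1) f'`. Since `f'² ≤ q₂ f f''` for `q₂` slightly above `q₀`, a constant `κ < 1` is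
possible as soon as `(a - 1)² q₂ < 1`. Away from `0` nothing is known about `q`, so `φ` is continued
as a multiple of `f` (`exists_energy_estimate_rpow`). For `q₁` slightly below `q₀`, `f' ≥ c
f^(1/q₁)` on the range of `u` (`exists_rpow_le_deriv`). As `φ ≤ f^a`, the function `w = φ(u)`
satisfies `∫ w^(2+s) η² ≤ C ∫ w² |∇η|²` with `s = 1/(a q₁)`. Cutoffs on balls of radius `R` bound a
fixed positive integral by a multiple of `R^(N - 2(2+s)/s)` (`not_caccioppoli`), which is absurd
when `N < 4 a q₁ + 2`. Letting `a → 1 + 1/√q₀` and `q₁ → q₀`, the condition becomes `N < 4 q₀ + 4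
√q₀ + 2`, which follows from the hypothesis on `p₀` (`dimension_lt`).

If `f(0) > 0`, then `f'(u)` is bounded below by a positive constant and stability alone gives the
contradiction. -/

namespace StableLiouville

open Convolution ContinuousLinearMap
open scoped NNReal Pointwise

/-! ### Stability inequality for Lipschitz test functions, by mollification. -/

/-- A bounded measurable function vanishing outside a compact set is integrable. -/
theorem integrable_of_bound_on_compact {N : ℕ} {F : Type*} [NormedAddCommGroup F]
    {g : Space N → F} {K : Set (Space N)} (hK : IsCompact K) (C : ℝ)
    (hg : AEStronglyMeasurable g volume) (hbound : ∀ x ∈ K, ‖g x‖ ≤ C)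
    (hzero : ∀ x, x ∉ K → g x = 0) : Integrable g volume := by
  have hsupp : Function.support g ⊆ K := fun x hx => by
    by_contra h
    exact hx (hzero x h)
  rw [← integrableOn_iff_integrable_of_support_subset hsupp]
  exact Measure.integrableOn_of_bounded hK.measure_lt_top.ne hg
    (ae_restrict_of_forall_mem hK.measurableSet hbound)

theorem norm_gradient {N : ℕ} (T : Space N → ℝ) (x : Space N) :
    ‖gradient T x‖ = ‖fderiv ℝ T x‖ := by
  simp [gradient]

theorem measurable_gradient {N : ℕ} (T : Space N → ℝ) : Measurable (gradient T) := by
  unfold gradient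
  exact (InnerProductSpace.toDual ℝ (Space N)).symm.continuous.measurable.comp
    (measurable_fderiv ℝ T)

theorem norm_gradient_le {N : ℕ} {T : Space N → ℝ} {K : ℝ≥0} (hT : LipschitzWith K T)
    (x : Space N) : ‖gradient T x‖ ≤ K := by
  rw [norm_gradient]
  exact norm_fderiv_le_of_lipschitz ℝ hT

/-- The gradient of a function vanishes outside its topological support. -/
theorem gradient_eq_zero {N : ℕ} {T : Space N → ℝ} {x : Space N} (hx : x ∉ tsupport T) :
    gradient T x = 0 := by
  have h : fderiv ℝ T x = 0 := by
    by_contra h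
    exact hx (support_fderiv_subset ℝ h)
  simp [gradient, h]

theorem integrable_norm_gradient_sq {N : ℕ} {T : Space N → ℝ} {K : ℝ≥0}
    (hT : LipschitzWith K T) (hc : HasCompactSupport T) :
    Integrable (fun x => ‖gradient T x‖ ^ 2) volume := by
  refine integrable_of_bound_on_compact hc (K ^ 2)
    ((measurable_gradient T).norm.pow_const 2).aestronglyMeasurable (fun x _ => ?_)
    (fun x hx => by simp [gradient_eq_zero hx])
  rw [norm_pow, norm_norm]
  exact pow_le_pow_left₀ (norm_nonneg _) (norm_gradient_le hT x) 2

/-- The derivative of the mollification of a Lipschitz function is the mollification of its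
almost everywhere defined derivative. -/
theorem hasFDerivAt_convolution_of_lipschitz {N : ℕ} {T : Space N → ℝ} {K : ℝ≥0}
    (hT : LipschitzWith K T) (ρ : Space N → ℝ) (hρ : Continuous ρ)
    (hρc : HasCompactSupport ρ) (x : Space N) :
    HasFDerivAt (ρ ⋆[lsmul ℝ ℝ, volume] T)
      ((ρ ⋆[lsmul ℝ ℝ, volume] (fderiv ℝ T)) x) x := by
  have hρi : Integrable ρ volume := hρ.integrable_of_hasCompactSupport hρc
  have hmeas : ∀ y, AEStronglyMeasurable (fun t => ρ t * T (y - t)) volume := fun y =>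
    (hρ.mul (hT.continuous.comp (by fun_prop))).aestronglyMeasurable
  -- The derivative falls on `T`, not on `ρ`: the Lipschitz constant gives the dominating function,
  -- and Rademacher's theorem gives differentiability for almost every `t`.
  have key := hasFDerivAt_integral_of_dominated_loc_of_lip (𝕜 := ℝ) (μ := volume)
    (F := fun y t => ρ t * T (y - t)) (F' := fun t => ρ t • fderiv ℝ T (x - t)) (x₀ := x)
    (bound := fun t => ρ t * K) (s := Set.univ) univ_mem (Eventually.of_forall hmeas)
    ((hρ.mul (hT.continuous.comp (by fun_prop))).integrable_of_hasCompactSupport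
      hρc.mul_right)
    (hρ.aestronglyMeasurable.smul
      ((measurable_fderiv ℝ T).comp (measurable_const.sub measurable_id)).aestronglyMeasurable)
    ?_ (hρi.mul_const _) ?_
  · exact key.2
  · refine Eventually.of_forall fun t => LipschitzWith.lipschitzOnWith ?_
    refine LipschitzWith.of_dist_le_mul fun y z => ?_
    rw [Real.dist_eq, ← mul_sub, abs_mul, Real.coe_nnabs, abs_mul, NNReal.abs_eq, mul_assoc]
    refine mul_le_mul_of_nonneg_left ?_ (abs_nonneg _)
    have := hT.dist_le_mul (y - t) (z - t)
    rwa [Real.dist_eq, dist_sub_right] at this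
  · have h1 : ∀ᵐ t : Space N, DifferentiableAt ℝ T (x - t) :=
      (Measure.measurePreserving_sub_left volume x).quasiMeasurePreserving.ae
        hT.ae_differentiableAt
    filter_upwards [h1] with t ht
    have h2 : HasFDerivAt (fun y : Space N => y - t) (ContinuousLinearMap.id ℝ (Space N)) x :=
      (hasFDerivAt_id x).sub_const t
    have h3 := (ht.hasFDerivAt.comp x h2).const_mul (ρ t)
    simpa using h3

theorem norm_normed_convolution_le {N : ℕ} {F : Type*} [NormedAddCommGroup F] [NormedSpace ℝ F]
    (φ : ContDiffBump (0 : Space N)) {g : Space N → F} {C : ℝ} (hg : ∀ x, ‖g x‖ ≤ C)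
    (x : Space N) : ‖(φ.normed volume ⋆[lsmul ℝ ℝ, volume] g) x‖ ≤ C := by
  have h1 : ∀ t, ‖φ.normed volume t • g (x - t)‖ ≤ φ.normed volume t * C := fun t => by
    rw [norm_smul, Real.norm_of_nonneg (φ.nonneg_normed t)]
    exact mul_le_mul_of_nonneg_left (hg _) (φ.nonneg_normed t)
  have h2 := norm_integral_le_of_norm_le (φ.integrable_normed (μ := volume) |>.mul_const C)
    (Eventually.of_forall h1)
  rw [integral_mul_const, φ.integral_normed, one_mul] at h2
  simpa [convolution_def] using h2

/-- Smooth approximation of a compactly supported Lipschitz function, with gradients converging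
almost everywhere. -/
theorem exists_contDiff_approx {N : ℕ} {T : Space N → ℝ} {K : ℝ≥0} (hT : LipschitzWith K T)
    (hc : HasCompactSupport T) :
    ∃ (A : ℕ → Space N → ℝ) (S : Set (Space N)) (C : ℝ), IsCompact S ∧
      (∀ n, ContDiff ℝ 1 (A n)) ∧ (∀ n, HasCompactSupport (A n)) ∧ (∀ n, tsupport (A n) ⊆ S) ∧
      (∀ n x, ‖A n x‖ ≤ C) ∧ (∀ n x, ‖fderiv ℝ (A n) x‖ ≤ K) ∧
      (∀ x, Tendsto (fun n => A n x) atTop (𝓝 (T x))) ∧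
      (∀ᵐ x, Tendsto (fun n => fderiv ℝ (A n) x) atTop (𝓝 (fderiv ℝ T x))) := by
  -- The fixed ratio 2 between outer and inner radius is what almost everywhere convergence at
  -- Lebesgue points requires; outer radii at most 2 give a common compact support.
  let φ : ℕ → ContDiffBump (0 : Space N) := fun n =>
    ⟨1 / ((n : ℝ) + 1), 2 * (1 / ((n : ℝ) + 1)), by positivity, by
      have : 0 < 1 / ((n : ℝ) + 1) := by positivity
      linarith⟩
  have hφ : Tendsto (fun n => (φ n).rOut) atTop (𝓝 0) := by
    have h := (tendsto_one_div_add_atTop_nhds_zero_nat (𝕜 := ℝ)).const_mul 2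
    rwa [mul_zero] at h
  have hφ2 : ∀ n, (φ n).rOut ≤ 2 := fun n => by
    have : 1 / ((n : ℝ) + 1) ≤ 1 := by
      rw [div_le_one (by positivity)]
      linarith [n.cast_nonneg (α := ℝ)]
    change 2 * (1 / ((n : ℝ) + 1)) ≤ 2
    linarith
  obtain ⟨C, hC⟩ := hT.continuous.bounded_above_of_compact_support hc
  have hfd : ∀ n x, fderiv ℝ ((φ n).normed volume ⋆[lsmul ℝ ℝ, volume] T) x =
      ((φ n).normed volume ⋆[lsmul ℝ ℝ, volume] (fderiv ℝ T)) x := fun n x =>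
    (hasFDerivAt_convolution_of_lipschitz hT _ (φ n).continuous_normed
      (φ n).hasCompactSupport_normed x).fderiv
  refine ⟨fun n => (φ n).normed volume ⋆[lsmul ℝ ℝ, volume] T,
    tsupport T + Metric.closedBall 0 2, C, hc.isCompact.add (isCompact_closedBall 0 2),
    fun n => ?_, fun n => ?_, fun n => ?_, fun n x => norm_normed_convolution_le _ hC x,
    fun n x => ?_, fun x => ?_, ?_⟩
  · exact_mod_cast (φ n).hasCompactSupport_normed.contDiff_convolution_left (n := 1)
      (lsmul ℝ ℝ) (φ n).contDiff_normed hT.continuous.locallyIntegrable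
  · exact (φ n).hasCompactSupport_normed.convolution _ hc
  · refine closure_minimal ?_ (hc.isCompact.add (isCompact_closedBall 0 2)).isClosed
    refine (support_convolution_subset_swap _).trans (Set.add_subset_add subset_closure ?_)
    rw [(φ n).support_normed_eq]
    exact Metric.ball_subset_closedBall.trans (Metric.closedBall_subset_closedBall (hφ2 n))
  · rw [hfd]
    exact norm_normed_convolution_le _ (fun y => norm_fderiv_le_of_lipschitz ℝ hT) x
  · exact ContDiffBump.convolution_tendsto_right_of_continuous hφ hT.continuous x
  · simp_rw [hfd]
    refine ContDiffBump.ae_convolution_tendsto_right_of_locallyIntegrable (K := 2) hφ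
      (Eventually.of_forall fun n => le_rfl) ?_
    refine (locallyIntegrable_const (K : ℝ)).mono
      (measurable_fderiv ℝ T).aestronglyMeasurable (Eventually.of_forall fun x => ?_)
    simpa using norm_fderiv_le_of_lipschitz ℝ hT

/-- A stable function satisfies the stability inequality for compactly supported Lipschitz test
functions. -/
theorem IsStable.integral_le {N : ℕ} {f : ℝ → ℝ} {u : Space N → ℝ} (hs : IsStable f u)
    (hcont : Continuous fun x => deriv f (u x)) {T : Space N → ℝ} {K : ℝ≥0}
    (hT : LipschitzWith K T) (hc : HasCompactSupport T) :
    ∫ x, deriv f (u x) * T x ^ 2 ≤ ∫ x, ‖gradient T x‖ ^ 2 := by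
  obtain ⟨A, S, C, hS, hA1, hAc, hAS, hAC, hAK, hAT, hAd⟩ := exists_contDiff_approx hT hc
  have hC : 0 ≤ C := (norm_nonneg _).trans (hAC 0 0)
  have hzero : ∀ n x, x ∉ S → A n x = 0 := fun n x hx =>
    image_eq_zero_of_notMem_tsupport fun h => hx (hAS n h)
  obtain ⟨D, hD⟩ := hS.exists_bound_of_continuousOn hcont.continuousOn
  have hind : ∀ c : ℝ, Integrable (S.indicator fun _ : Space N => c) volume := fun c =>
    (integrable_indicator_iff hS.measurableSet).2 (integrableOn_const hS.measure_lt_top.ne)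
  have hL : Tendsto (fun n => ∫ x, deriv f (u x) * A n x ^ 2) atTop
      (𝓝 (∫ x, deriv f (u x) * T x ^ 2)) := by
    refine tendsto_integral_of_dominated_convergence (S.indicator fun _ => D * C ^ 2)
      (fun n => (hcont.mul ((hA1 n).continuous.pow 2)).aestronglyMeasurable) (hind _)
      (fun n => Eventually.of_forall fun x => ?_)
      (Eventually.of_forall fun x => ((hAT x).pow 2).const_mul _)
    by_cases hx : x ∈ S
    · rw [Set.indicator_of_mem hx, norm_mul, norm_pow]
      exact mul_le_mul (hD x hx) (pow_le_pow_left₀ (norm_nonneg _) (hAC n x) 2) (by positivity)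
        ((norm_nonneg _).trans (hD x hx))
    · simp [hzero n x hx, hx]
  have hR : Tendsto (fun n => ∫ x, ‖gradient (A n) x‖ ^ 2) atTop
      (𝓝 (∫ x, ‖gradient T x‖ ^ 2)) := by
    refine tendsto_integral_of_dominated_convergence (S.indicator fun _ => (K : ℝ) ^ 2)
      (fun n => ((measurable_gradient (A n)).norm.pow_const 2).aestronglyMeasurable) (hind _)
      (fun n => Eventually.of_forall fun x => ?_) ?_
    · by_cases hx : x ∈ S
      · rw [Set.indicator_of_mem hx, norm_pow, norm_norm, norm_gradient]
        exact pow_le_pow_left₀ (norm_nonneg _) (hAK n x) 2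
      · simp [gradient_eq_zero fun h => hx (hAS n h), hx]
    · filter_upwards [hAd] with x hx
      simp_rw [norm_gradient]
      exact hx.norm.pow 2
  exact le_of_tendsto_of_tendsto' hL hR fun n => hs (A n) (hA1 n) (hAc n)

/-! ### Classical subsolutions are weak subsolutions. -/

/-- Integration by parts of a `C¹` function against a compactly supported Lipschitz function. -/
theorem integral_fderiv_mul_eq_neg {N : ℕ} {g T : Space N → ℝ} {K : ℝ≥0} (hg : ContDiff ℝ 1 g)
    (hT : LipschitzWith K T) (hc : HasCompactSupport T) (v : Space N) :
    ∫ x, fderiv ℝ g x v * T x = -∫ x, g x * fderiv ℝ T x v := by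
  obtain ⟨r, hr0, hr⟩ : ∃ r : ℝ, 0 < r ∧ tsupport T ⊆ Metric.ball 0 r := by
    obtain ⟨r, hr⟩ := hc.isCompact.isBounded.subset_ball 0
    exact ⟨max r 1, by positivity, hr.trans (Metric.ball_subset_ball (le_max_left _ _))⟩
  -- Multiplying `g` by a bump equal to 1 near `tsupport T` makes it globally Lipschitz and changes
  -- neither integral.
  let χ : ContDiffBump (0 : Space N) := ⟨r, r + 1, hr0, by linarith⟩
  have hχg : ContDiff ℝ 1 fun x => χ x * g x := χ.contDiff.mul hg
  obtain ⟨C, hC⟩ := hχg.lipschitzWith_of_hasCompactSupport χ.hasCompactSupport.mul_right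
    one_ne_zero
  have heq : ∀ x ∈ tsupport T, (fun y => χ y * g y) =ᶠ[𝓝 x] g := fun x hx => by
    filter_upwards [Metric.isOpen_ball.mem_nhds (hr hx)] with y hy
    rw [χ.one_of_mem_closedBall (Metric.ball_subset_closedBall hy), one_mul]
  have key := hC.integral_lineDeriv_mul_eq (μ := volume) hT hc v
  have h1 : ∫ x, lineDeriv ℝ (fun y => χ y * g y) x v * T x = ∫ x, fderiv ℝ g x v * T x := by
    refine integral_congr_ae (Eventually.of_forall fun x => ?_)
    by_cases hx : x ∈ tsupport T
    · simp only
      rw [(hχg.differentiable one_ne_zero x).lineDeriv_eq_fderiv, (heq x hx).fderiv_eq]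
    · simp [image_eq_zero_of_notMem_tsupport hx]
  have h2 : ∫ x, lineDeriv ℝ T x (-v) * (χ x * g x) = -∫ x, g x * fderiv ℝ T x v := by
    rw [← integral_neg]
    refine integral_congr_ae ?_
    filter_upwards [hT.ae_differentiableAt] with x hx
    rw [hx.lineDeriv_eq_fderiv, map_neg]
    by_cases hxs : x ∈ tsupport T
    · have := (heq x hxs).self_of_nhds
      simp only at this
      rw [this]
      ring
    · have : fderiv ℝ T x = 0 := by
        by_contra h
        exact hxs (support_fderiv_subset ℝ h)
      simp [this]
  exact h1.symm.trans (key.trans h2)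

/-- A classical subsolution is a weak subsolution. -/
theorem IsClassicalSubsolution.isWeakSubsolution {N : ℕ} {f : ℝ → ℝ} {u : Space N → ℝ}
    (hu : IsClassicalSubsolution f u) (hcont : Continuous fun x => f (u x)) :
    IsWeakSubsolution f u := by
  obtain ⟨hu2, hle⟩ := hu
  refine ⟨(hu2.of_le (by norm_num)).locallyLipschitz, ?_⟩
  rintro T ⟨K, hT⟩ hc hT0
  let b := EuclideanSpace.basisFun (Fin N) ℝ
  let g : Fin N → Space N → ℝ := fun i x => fderiv ℝ u x (b i)
  have hg : ∀ i, ContDiff ℝ 1 (g i) := fun i =>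
    (hu2.fderiv_right (m := 1) (by norm_num)).clm_apply contDiff_const
  have hgrad : ∀ (w : Space N → ℝ) (x : Space N) (i : Fin N),
      inner ℝ (gradient w x) (b i) = fderiv ℝ w x (b i) := fun w x i => by
    simp [gradient]
  have hinner : ∀ x, inner ℝ (gradient u x) (gradient T x) =
      ∑ i, g i x * fderiv ℝ T x (b i) := fun x => by
    rw [← b.sum_inner_mul_inner]
    refine Finset.sum_congr rfl fun i _ => ?_
    rw [hgrad, real_inner_comm, hgrad]
  have hlap : ∀ x, Laplacian.laplacian u x = ∑ i, fderiv ℝ (g i) x (b i) := fun x => by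
    rw [InnerProductSpace.laplacian_eq_iteratedFDeriv_orthonormalBasis u b]
    refine Finset.sum_congr rfl fun i _ => ?_
    rw [iteratedFDeriv_two_apply]
    have hd : DifferentiableAt ℝ (fderiv ℝ u) x :=
      (hu2.fderiv_right (m := 1) (by norm_num)).differentiable one_ne_zero x
    simp only [g]
    rw [fderiv_clm_apply hd (differentiableAt_const _)]
    simp
  have hTm : ∀ v, Measurable fun x => fderiv ℝ T x v := fun v =>
    measurable_fderiv_apply_const ℝ T v
  have hi1 : ∀ i, Integrable (fun x => g i x * fderiv ℝ T x (b i)) volume := fun i => by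
    obtain ⟨C, hC⟩ := hc.isCompact.exists_bound_of_continuousOn (hg i).continuous.continuousOn
    refine integrable_of_bound_on_compact hc (C * K)
      ((hg i).continuous.measurable.mul (hTm _)).aestronglyMeasurable (fun x hx => ?_)
      (fun x hx => ?_)
    · rw [norm_mul]
      refine mul_le_mul (hC x hx) ?_ (norm_nonneg _) ((norm_nonneg _).trans (hC x hx))
      refine ((fderiv ℝ T x).le_opNorm _).trans ?_
      rw [b.norm_eq_one, mul_one]
      exact norm_fderiv_le_of_lipschitz ℝ hT
    · have : fderiv ℝ T x = 0 := by
        by_contra h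
        exact hx (support_fderiv_subset ℝ h)
      simp [this]
  have hi2 : ∀ i, Integrable (fun x => fderiv ℝ (g i) x (b i) * T x) volume := fun i =>
    ((((hg i).continuous_fderiv one_ne_zero).clm_apply continuous_const).mul
      hT.continuous).integrable_of_hasCompactSupport hc.mul_left
  have hsum : ∫ x, inner ℝ (gradient u x) (gradient T x) =
      ∫ x, -(Laplacian.laplacian u x) * T x := by
    simp_rw [hinner, hlap, ← Finset.sum_neg_distrib, Finset.sum_mul, neg_mul]
    rw [integral_finsetSum _ fun i _ => hi1 i,
      integral_finsetSum (f := fun i x => -(fderiv ℝ (g i) x (b i) * T x)) _ fun i _ => (hi2 i).neg]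
    refine Finset.sum_congr rfl fun i _ => ?_
    rw [integral_neg, integral_fderiv_mul_eq_neg (hg i) hT hc, neg_neg]
  rw [hsum]
  refine integral_mono ?_ ((hcont.mul hT.continuous).integrable_of_hasCompactSupport hc.mul_left)
    fun x => mul_le_mul_of_nonneg_right (hle x) (hT0 x)
  simp_rw [hlap, ← Finset.sum_neg_distrib, Finset.sum_mul, neg_mul]
  exact integrable_finsetSum _ fun i _ => (hi2 i).neg

/-! ### Chain rules and the energy estimate. -/

theorem gradient_comp {N : ℕ} {g : ℝ → ℝ} {u : Space N → ℝ} {x : Space N}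
    (hg : DifferentiableAt ℝ g (u x)) (hu : DifferentiableAt ℝ u x) :
    gradient (fun y => g (u y)) x = deriv g (u x) • gradient u x := by
  have h : fderiv ℝ (fun y => g (u y)) x = deriv g (u x) • fderiv ℝ u x :=
    (hg.hasDerivAt.comp_hasFDerivAt x hu.hasFDerivAt).fderiv
  simp [gradient, h]

theorem gradient_mul {N : ℕ} {v w : Space N → ℝ} {x : Space N}
    (hv : DifferentiableAt ℝ v x) (hw : DifferentiableAt ℝ w x) :
    gradient (fun y => v y * w y) x = v x • gradient w x + w x • gradient v x := by
  have h : fderiv ℝ (fun y => v y * w y) x = v x • fderiv ℝ w x + w x • fderiv ℝ v x :=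
    (hv.hasFDerivAt.mul hw.hasFDerivAt).fderiv
  simp [gradient, h]

/-- On a compact set, a positive bounded locally Lipschitz function coincides with a globally
Lipschitz function with values in a compact subinterval of `(0, ∞)`. -/
theorem exists_lipschitz_modification {N : ℕ} {u : Space N → ℝ} (hu : LocallyLipschitz u)
    (hpos : ∀ x, 0 < u x) {M : ℝ} (hM : ∀ x, u x ≤ M) {S : Set (Space N)} (hS : IsCompact S) :
    ∃ (v : Space N → ℝ) (m : ℝ) (K : ℝ≥0), 0 < m ∧ LipschitzWith K v ∧
      (∀ x, v x ∈ Set.Icc m M) ∧ Set.EqOn u v S := by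
  obtain ⟨m, hm, hmM, hmS⟩ : ∃ m, 0 < m ∧ m ≤ M ∧ ∀ x ∈ S, m ≤ u x := by
    rcases S.eq_empty_or_nonempty with rfl | hne
    · exact ⟨M, (hpos 0).trans_le (hM 0), le_rfl, by simp⟩
    · obtain ⟨y, -, hy⟩ := hS.exists_isMinOn hne hu.continuous.continuousOn
      exact ⟨u y, hpos y, hM y, fun x hx => hy hx⟩
  obtain ⟨K, hK⟩ :=
    LocallyLipschitzOn.exists_lipschitzOnWith_of_compact hS (hu.locallyLipschitzOn (s := S))
  obtain ⟨w, hw, hwu⟩ := hK.extend_real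
  -- Clamping the global Lipschitz extension to `[m, M]` keeps the Lipschitz constant and changes
  -- nothing on `S`.
  refine ⟨fun x => max m (min M (w x)), m, K, hm, (hw.const_min M).const_max m,
    fun x => ⟨le_max_left _ _, max_le hmM (min_le_left _ _)⟩, fun x hx => ?_⟩
  change u x = max m (min M (w x))
  rw [← hwu hx, min_eq_right (hM x), max_eq_right (hmS x hx)]

/-- A bounded Lipschitz function times a compactly supported Lipschitz function is Lipschitz. -/
theorem exists_lipschitzWith_mul {N : ℕ} {v w : Space N → ℝ} {K L : ℝ≥0} {C : ℝ}
    (hv : LipschitzWith K v) (hC : ∀ x, |v x| ≤ C) (hw : LipschitzWith L w)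
    (hc : HasCompactSupport w) : ∃ D, LipschitzWith D fun x => v x * w x := by
  obtain ⟨B, hB⟩ := hw.continuous.bounded_above_of_compact_support hc
  have hC0 : 0 ≤ C := (abs_nonneg _).trans (hC 0)
  have hB0 : 0 ≤ B := (norm_nonneg _).trans (hB 0)
  refine ⟨(C * L + B * K).toNNReal, LipschitzWith.of_dist_le_mul fun x y => ?_⟩
  have h1 := hv.dist_le_mul x y
  have h2 := hw.dist_le_mul x y
  rw [Real.dist_eq] at *
  have h3 : v x * w x - v y * w y = v x * (w x - w y) + w y * (v x - v y) := by ring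
  rw [h3]
  refine (abs_add_le _ _).trans ?_
  rw [abs_mul, abs_mul]
  have h4 := mul_le_mul (hC x) h2 (abs_nonneg _) hC0
  have h5 := mul_le_mul (hB y) h1 (abs_nonneg _) hB0
  rw [Real.norm_eq_abs] at h5
  calc _ ≤ _ := add_le_add h4 h5
    _ = _ := by
      rw [Real.coe_toNNReal _ (by positivity)]
      ring

/-- The pointwise inequality behind the energy estimate. -/
theorem norm_sq_le_of_le {N : ℕ} (p e : Space N) {k a a' b b' η : ℝ} (hk : 1 < k) (ha : 0 ≤ a)
    (ha' : 0 ≤ a') (hb : 0 ≤ b) (hbb' : a' ^ 2 ≤ b') (hba : b ≤ a * a') :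
    ‖a • e + η • (a' • p)‖ ^ 2 ≤
      k * inner ℝ p (b • ((2 * η) • e) + η ^ 2 • (b' • p)) +
        (1 + (k + 1) ^ 2 / (k - 1)) * (a ^ 2 * ‖e‖ ^ 2) := by
  set X := a' * |η| * ‖p‖ with hX
  set Y := a * ‖e‖ with hY
  have h1 : ‖a • e + η • (a' • p)‖ ≤ X + Y := by
    refine (norm_add_le _ _).trans (le_of_eq ?_)
    rw [norm_smul, norm_smul, norm_smul, Real.norm_of_nonneg ha, Real.norm_of_nonneg ha',
      Real.norm_eq_abs]
    ring
  have h2 : ‖a • e + η • (a' • p)‖ ^ 2 ≤ (X + Y) ^ 2 := pow_le_pow_left₀ (norm_nonneg _) h1 2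
  have h3 : inner ℝ p (b • ((2 * η) • e) + η ^ 2 • (b' • p)) =
      2 * (b * (η * inner ℝ p e)) + b' * (η ^ 2 * ‖p‖ ^ 2) := by
    rw [inner_add_right, inner_smul_right, inner_smul_right, inner_smul_right, inner_smul_right,
      real_inner_self_eq_norm_sq]
    ring
  have h4 : X ^ 2 ≤ b' * (η ^ 2 * ‖p‖ ^ 2) := by
    have : X ^ 2 = a' ^ 2 * (η ^ 2 * ‖p‖ ^ 2) := by
      rw [hX, mul_pow, mul_pow, sq_abs]
      ring
    rw [this]
    exact mul_le_mul_of_nonneg_right hbb' (by positivity)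
  have h5 : -(X * Y) ≤ b * (η * inner ℝ p e) := by
    refine neg_le_of_abs_le ?_
    rw [abs_mul, abs_mul, abs_of_nonneg hb]
    calc b * (|η| * |inner ℝ p e|) ≤ (a * a') * (|η| * (‖p‖ * ‖e‖)) := by
          gcongr
          exact abs_real_inner_le_norm p e
      _ = X * Y := by rw [hX, hY]; ring
  have h6 : k * (X ^ 2 - 2 * (X * Y)) ≤ k * (2 * (b * (η * inner ℝ p e)) +
      b' * (η ^ 2 * ‖p‖ ^ 2)) := by
    apply mul_le_mul_of_nonneg_left _ (by linarith)
    linarith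
  have h7 : a ^ 2 * ‖e‖ ^ 2 = Y ^ 2 := by rw [hY]; ring
  have hk1 : 0 < k - 1 := by linarith
  -- With only `b ≤ a a'`, the mixed terms need not cancel and cost up to `2 (k + 1) X Y`; the
  -- surplus `(k - 1) X²` absorbs them after completing the square.
  have h8 : (k + 1) ^ 2 / (k - 1) * Y ^ 2 + (k - 1) * X ^ 2 - 2 * (k + 1) * (X * Y) =
      ((k + 1) * Y - (k - 1) * X) ^ 2 / (k - 1) := by
    field_simp
    ring
  have h9 : 0 ≤ ((k + 1) * Y - (k - 1) * X) ^ 2 / (k - 1) := by positivity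
  rw [h3, h7]
  nlinarith

/-- The energy estimate: testing stability with `φ(u) η` and the differential inequality
with `ψ(u) η²`. -/
theorem energy_estimate {N : ℕ} {f φ ψ : ℝ → ℝ} {u : Space N → ℝ} {M c ε : ℝ}
    (hweak : IsWeakSubsolution f u) (hstab : IsStable f u) (hpos : ∀ x, 0 < u x)
    (hM : ∀ x, u x ≤ M) (hfc : Continuous fun x => f (u x))
    (hfc' : Continuous fun x => deriv f (u x))
    (hε : ∀ᵐ x, u x ≠ ε) (hc : 0 < c)
    (hφL : ∀ m, 0 < m → ∃ K, LipschitzOnWith K φ (Set.Icc m M))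
    (hψL : ∀ m, 0 < m → ∃ K, LipschitzOnWith K ψ (Set.Icc m M))
    (hφ0 : ∀ t, 0 < t → 0 ≤ φ t) (hψ0 : ∀ t, 0 < t → 0 ≤ ψ t)
    (hφd : ∀ t, 0 < t → t ≠ ε → DifferentiableAt ℝ φ t)
    (hψd : ∀ t, 0 < t → t ≠ ε → DifferentiableAt ℝ ψ t)
    (hφ' : ∀ t, 0 < t → t ≠ ε → 0 ≤ deriv φ t)
    (hφψ : ∀ t, 0 < t → t ≠ ε → deriv φ t ^ 2 ≤ deriv ψ t)
    (hψφ : ∀ t, 0 < t → t ≠ ε → ψ t ≤ φ t * deriv φ t)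
    (hfψ : ∀ t, 0 < t → t ≤ M → f t * ψ t ≤ (1 - c) * (deriv f t * φ t ^ 2)) :
    ∃ C, ∀ η : Space N → ℝ, (∃ K, LipschitzWith K η) → HasCompactSupport η →
      ∫ x, deriv f (u x) * φ (u x) ^ 2 * η x ^ 2 ≤ C * ∫ x, φ (u x) ^ 2 * ‖gradient η x‖ ^ 2 := by
  -- The product `k (1 - c) = 1 - c²` stays below 1, so `c²` times the left side survives
  -- absorption.
  set k := 1 + c with hk
  set D := 1 + (k + 1) ^ 2 / (k - 1) with hD
  refine ⟨D / c ^ 2, ?_⟩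
  rintro η ⟨L, hη⟩ hηc
  obtain ⟨r, hr⟩ := hηc.isCompact.isBounded.subset_ball 0
  -- `φ` and `ψ` are controlled only away from `0`, and `u` is only locally Lipschitz; near the
  -- support of `η`, `u` is replaced by a Lipschitz `v` with values in `[m, M]`.
  obtain ⟨v, m, K, hm, hv, hvm, huv⟩ :=
    exists_lipschitz_modification hweak.1 hpos hM (isCompact_closedBall (0 : Space N) r)
  have huvη : ∀ x ∈ tsupport η, u =ᶠ[𝓝 x] v := fun x hx => by
    filter_upwards [Metric.isOpen_ball.mem_nhds (hr hx)] with y hy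
    exact huv (Metric.ball_subset_closedBall hy)
  have huvη' : ∀ x ∈ tsupport η, u x = v x := fun x hx => (huvη x hx).self_of_nhds
  have hcomp : ∀ g : ℝ → ℝ, (∃ K, LipschitzOnWith K g (Set.Icc m M)) →
      ∃ (K' : ℝ≥0) (B : ℝ), LipschitzWith K' (fun x => g (v x)) ∧ ∀ x, |g (v x)| ≤ B := by
    rintro g ⟨K', hK'⟩
    obtain ⟨B, hB⟩ := isCompact_Icc.exists_bound_of_continuousOn hK'.continuousOn
    refine ⟨K' * K, B, ?_, fun x => hB _ (hvm x)⟩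
    have h := hK'.comp (hv.lipschitzOnWith (s := Set.univ)) fun x _ => hvm x
    exact lipschitzOnWith_univ.1 h
  obtain ⟨Kφ, Bφ, hφv, hBφ⟩ := hcomp φ (hφL m hm)
  obtain ⟨Kψ, Bψ, hψv, hBψ⟩ := hcomp ψ (hψL m hm)
  have hη2c : HasCompactSupport fun x => η x * η x := hηc.mul_left
  obtain ⟨L2, hη2⟩ : ∃ D, LipschitzWith D fun x => η x * η x := by
    obtain ⟨B, hB⟩ := hη.continuous.bounded_above_of_compact_support hηc
    exact exists_lipschitzWith_mul hη hB hη hηc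
  set T₁ : Space N → ℝ := fun x => φ (u x) * η x with hT₁
  set T₂ : Space N → ℝ := fun x => ψ (u x) * (η x * η x) with hT₂
  have hT₁v : T₁ = fun x => φ (v x) * η x := by
    funext x
    by_cases hx : x ∈ tsupport η
    · simp only [hT₁, huvη' x hx]
    · simp [hT₁, image_eq_zero_of_notMem_tsupport hx]
  have hT₂v : T₂ = fun x => ψ (v x) * (η x * η x) := by
    funext x
    by_cases hx : x ∈ tsupport η
    · simp only [hT₂, huvη' x hx]
    · simp [hT₂, image_eq_zero_of_notMem_tsupport hx]
  obtain ⟨K₁, hK₁⟩ : ∃ D, LipschitzWith D T₁ := by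
    rw [hT₁v]
    exact exists_lipschitzWith_mul hφv hBφ hη hηc
  obtain ⟨K₂, hK₂⟩ : ∃ D, LipschitzWith D T₂ := by
    rw [hT₂v]
    exact exists_lipschitzWith_mul hψv hBψ hη2 hη2c
  have hT₁c : HasCompactSupport T₁ := hηc.mul_left
  have hT₂c : HasCompactSupport T₂ := hη2c.mul_left
  have hT₁s : tsupport T₁ ⊆ tsupport η := tsupport_mul_subset_right
  have hT₂s : tsupport T₂ ⊆ tsupport η := tsupport_mul_subset_right.trans tsupport_mul_subset_right
  have hS := hstab.integral_le hfc' hK₁ hT₁c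
  have hW := hweak.2 T₂ ⟨K₂, hK₂⟩ hT₂c fun x => mul_nonneg (hψ0 _ (hpos x)) (mul_self_nonneg _)
  have hpt : ∀ᵐ x, ‖gradient T₁ x‖ ^ 2 ≤ k * inner ℝ (gradient u x) (gradient T₂ x) +
      D * (φ (u x) ^ 2 * ‖gradient η x‖ ^ 2) := by
    -- `φ` and `ψ` may have a corner at `ε`, so the chain rule is used off the null level set `u =
    -- ε`.
    filter_upwards [hε, hv.ae_differentiableAt, hη.ae_differentiableAt] with x hx hvx hηx
    by_cases hxs : x ∈ tsupport η
    · have hux : DifferentiableAt ℝ u x := hvx.congr_of_eventuallyEq (huvη x hxs)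
      have hφx := hφd (u x) (hpos x) hx
      have hψx := hψd (u x) (hpos x) hx
      have e1 : gradient T₁ x =
          φ (u x) • gradient η x + η x • (deriv φ (u x) • gradient u x) := by
        rw [← gradient_comp hφx hux]
        exact gradient_mul (hφx.comp x hux) hηx
      have e2 : gradient T₂ x = ψ (u x) • ((2 * η x) • gradient η x) +
          η x ^ 2 • (deriv ψ (u x) • gradient u x) := by
        have h3 := gradient_mul (hψx.comp x hux) (hηx.mul hηx)
        have h4 := gradient_mul hηx hηx
        rw [← gradient_comp hψx hux, two_mul, add_smul, ← h4, sq]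
        exact h3
      rw [e1, e2]
      exact norm_sq_le_of_le _ _ (by linarith) (hφ0 _ (hpos x)) (hφ' _ (hpos x) hx)
        (hψ0 _ (hpos x)) (hφψ _ (hpos x) hx) (hψφ _ (hpos x) hx)
    · rw [gradient_eq_zero fun h => hxs (hT₁s h), gradient_eq_zero fun h => hxs (hT₂s h),
        gradient_eq_zero hxs]
      simp
  have hφint : Integrable (fun x => φ (u x) ^ 2 * ‖gradient η x‖ ^ 2) volume := by
    have : (fun x => φ (u x) ^ 2 * ‖gradient η x‖ ^ 2) =
        fun x => φ (v x) ^ 2 * ‖gradient η x‖ ^ 2 := by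
      funext x
      by_cases hx : x ∈ tsupport η
      · rw [huvη' x hx]
      · simp [gradient_eq_zero hx]
    rw [this]
    refine (integrable_norm_gradient_sq hη hηc).bdd_mul (c := Bφ ^ 2)
      (hφv.continuous.pow 2).aestronglyMeasurable (Eventually.of_forall fun x => ?_)
    rw [norm_pow]
    exact pow_le_pow_left₀ (norm_nonneg _) (hBφ x) 2
  have hint : Integrable (fun x => inner ℝ (gradient u x) (gradient T₂ x)) volume := by
    refine integrable_of_bound_on_compact hηc (K * K₂)
      ((measurable_gradient u).inner (measurable_gradient T₂)).aestronglyMeasurable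
      (fun x hx => ?_) (fun x hx => by simp [gradient_eq_zero fun h => hx (hT₂s h)])
    have h1 : gradient u x = gradient v x := by
      simp [gradient, (huvη x hx).fderiv_eq]
    rw [h1]
    exact (norm_inner_le_norm _ _).trans (mul_le_mul (norm_gradient_le hv x)
      (norm_gradient_le hK₂ x) (norm_nonneg _) (by positivity))
  have hI1 := integral_mono_ae (integrable_norm_gradient_sq hK₁ hT₁c)
    ((hint.const_mul k).add (hφint.const_mul D)) hpt
  rw [integral_add' (hint.const_mul k) (hφint.const_mul D), integral_const_mul,
    integral_const_mul] at hI1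
  have hcT₁ : Integrable (fun x => deriv f (u x) * T₁ x ^ 2) volume :=
    (hfc'.mul (hK₁.continuous.pow 2)).integrable_of_hasCompactSupport
      (HasCompactSupport.mul_left (by simpa [sq] using hT₁c.mul_left))
  have hI2 : ∫ x, f (u x) * T₂ x ≤ (1 - c) * ∫ x, deriv f (u x) * T₁ x ^ 2 := by
    rw [← integral_const_mul]
    refine integral_mono ((hfc.mul hK₂.continuous).integrable_of_hasCompactSupport hT₂c.mul_left)
      (hcT₁.const_mul _) fun x => ?_
    have h := mul_le_mul_of_nonneg_right (hfψ (u x) (hpos x) (hM x)) (mul_self_nonneg (η x))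
    simp only [hT₁, hT₂]
    calc _ = _ := by ring
      _ ≤ _ := h
      _ = _ := by ring
  have heq : ∫ x, deriv f (u x) * φ (u x) ^ 2 * η x ^ 2 = ∫ x, deriv f (u x) * T₁ x ^ 2 :=
    integral_congr_ae (Eventually.of_forall fun x => by simp only [hT₁]; ring)
  rw [heq]
  set I := ∫ x, deriv f (u x) * T₁ x ^ 2
  set J := ∫ x, φ (u x) ^ 2 * ‖gradient η x‖ ^ 2
  have h1 : I ≤ k * ((1 - c) * I) + D * J := by
    have := mul_le_mul_of_nonneg_left (hW.trans hI2) (by linarith : (0 : ℝ) ≤ k)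
    linarith
  have h2 : c ^ 2 * I ≤ D * J := by
    rw [hk] at h1
    nlinarith
  rw [div_mul_eq_mul_div, le_div_iff₀ (by positivity)]
  linarith

/-! ### Cutoff functions and the Liouville property. -/

/-- The Lipschitz cutoff equal to `1` on the ball of radius `R` and to `0` outside the ball of
radius `2 R`. -/
noncomputable def cutoff (N : ℕ) (R : ℝ) (x : Space N) : ℝ := max 0 (min 1 (2 - ‖x‖ / R))

theorem cutoff_nonneg {N : ℕ} (R : ℝ) (x : Space N) : 0 ≤ cutoff N R x := le_max_left _ _

theorem cutoff_le_one {N : ℕ} (R : ℝ) (x : Space N) : cutoff N R x ≤ 1 :=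
  max_le zero_le_one (min_le_left _ _)

theorem cutoff_zero {N : ℕ} (R : ℝ) : cutoff N R 0 = 1 := by
  simp [cutoff]

theorem cutoff_mono {N : ℕ} {R : ℝ} (hR : 1 ≤ R) (x : Space N) :
    cutoff N 1 x ≤ cutoff N R x := by
  have : ‖x‖ / R ≤ ‖x‖ / 1 := div_le_div_of_nonneg_left (norm_nonneg _) one_pos hR
  exact max_le_max le_rfl (min_le_min le_rfl (by linarith))

theorem lipschitzWith_cutoff {N : ℕ} {R : ℝ} (hR : 0 < R) :
    LipschitzWith (R⁻¹).toNNReal (cutoff N R) := by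
  have h : LipschitzWith (R⁻¹).toNNReal fun x : Space N => 2 - ‖x‖ / R := by
    refine LipschitzWith.of_dist_le_mul fun x y => ?_
    rw [Real.coe_toNNReal _ (by positivity), Real.dist_eq, dist_eq_norm]
    have h1 : 2 - ‖x‖ / R - (2 - ‖y‖ / R) = R⁻¹ * (‖y‖ - ‖x‖) := by ring
    rw [h1, abs_mul, abs_of_pos (inv_pos.2 hR), ← norm_sub_rev y x]
    exact mul_le_mul_of_nonneg_left (abs_norm_sub_norm_le y x) (by positivity)
  exact (h.const_min 1).const_max 0

theorem tsupport_cutoff_subset {N : ℕ} {R : ℝ} (hR : 0 < R) :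
    tsupport (cutoff N R) ⊆ Metric.closedBall 0 (2 * R) := by
  refine closure_minimal (fun x hx => ?_) Metric.isClosed_closedBall
  by_contra h
  rw [mem_closedBall_zero_iff, not_le] at h
  have : 2 < ‖x‖ / R := by rwa [lt_div_iff₀ hR]
  exact hx (max_eq_left ((min_le_right _ _).trans (by linarith)))

theorem hasCompactSupport_cutoff {N : ℕ} {R : ℝ} (hR : 0 < R) :
    HasCompactSupport (cutoff N R) :=
  (isCompact_closedBall (0 : Space N) (2 * R)).of_isClosed_subset (isClosed_tsupport _)
    (tsupport_cutoff_subset hR)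

theorem exists_lipschitzWith_cutoff_pow {N : ℕ} {R : ℝ} (hR : 0 < R) (m : ℕ) :
    ∃ K, LipschitzWith K fun x => cutoff N R x ^ m := by
  obtain ⟨K, hK⟩ := LocallyLipschitzOn.exists_lipschitzOnWith_of_compact
    (isCompact_Icc (a := (0 : ℝ)) (b := 1))
    (((contDiff_id (𝕜 := ℝ) (E := ℝ)).pow m).locallyLipschitz.locallyLipschitzOn)
  have h := hK.comp ((lipschitzWith_cutoff (N := N) hR).lipschitzOnWith (s := Set.univ))
    fun x _ => ⟨cutoff_nonneg R x, cutoff_le_one R x⟩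
  exact ⟨_, lipschitzOnWith_univ.1 h⟩

/-- The absorption inequality used with powers of cutoff functions. -/
theorem exists_young_bound {p s A : ℝ} (hp : 0 < p) (hs : 0 < s) (hA : 0 ≤ A) {m : ℕ}
    (hm : (p + s) / s ≤ m) : ∃ B, 0 ≤ B ∧ ∀ w z ρ : ℝ, 0 < w → 0 ≤ z → z ≤ 1 → 0 ≤ ρ →
      A * ρ * (w ^ p * z ^ (2 * (m - 1))) ≤
        1 / 2 * (w ^ (p + s) * z ^ (2 * m)) + B * ρ ^ ((p + s) / s) := by
  have hps : 0 < p + s := by linarith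
  have hm1 : 1 < (m : ℝ) := lt_of_lt_of_le (by rw [lt_div_iff₀ hs]; linarith) hm
  have hm1' : 1 ≤ m := by exact_mod_cast hm1.le
  set θ := (p + s) / p
  set θ' := (p + s) / s
  have hθ : θ.HolderConjugate θ' := by
    rw [Real.holderConjugate_iff]
    refine ⟨by rw [lt_div_iff₀ hp]; linarith, ?_⟩
    simp only [θ, θ', inv_div]
    field_simp
  -- This weight in Young's inequality turns into the factor `1/2` after raising to the power `θ`.
  set δ : ℝ := (1 / 2) ^ θ⁻¹ with hδ
  have hδ0 : 0 < δ := by positivity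
  have hδθ : δ ^ θ = 1 / 2 := by
    rw [hδ, ← Real.rpow_mul (by norm_num), inv_mul_cancel₀ hθ.ne_zero, Real.rpow_one]
  refine ⟨(A / δ) ^ θ', by positivity, fun w z ρ hw hz hz1 hρ => ?_⟩
  have hy := Real.young_inequality_of_nonneg (a := δ * (w ^ p * z ^ (2 * (m - 1))))
    (b := A / δ * ρ) (by positivity) (by positivity) hθ
  have h1 : δ * (w ^ p * z ^ (2 * (m - 1))) * (A / δ * ρ) =
      A * ρ * (w ^ p * z ^ (2 * (m - 1))) := by
    field_simp
  have h2 : (δ * (w ^ p * z ^ (2 * (m - 1)))) ^ θ ≤ 1 / 2 * (w ^ (p + s) * z ^ (2 * m)) := by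
    rw [Real.mul_rpow hδ0.le (by positivity), hδθ, Real.mul_rpow (by positivity) (by positivity),
      ← Real.rpow_mul hw.le, mul_div_cancel₀ _ hp.ne']
    refine mul_le_mul_of_nonneg_left (mul_le_mul_of_nonneg_left ?_ (by positivity)) (by norm_num)
    rcases hz.eq_or_lt with rfl | hz0
    · have : 2 * (m - 1) ≠ 0 := by
        have : 2 ≤ m := by exact_mod_cast hm1
        omega
      rw [zero_pow this, Real.zero_rpow hθ.ne_zero]
      positivity
    -- Since `z ≤ 1`, it suffices that `2 (m - 1) θ ≥ 2 m`, which is equivalent to `m ≥ (p + s) /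
    -- s`.
    · rw [← Real.rpow_natCast, ← Real.rpow_natCast, ← Real.rpow_mul hz]
      refine Real.rpow_le_rpow_of_exponent_ge hz0 hz1 ?_
      push_cast [Nat.cast_sub hm1']
      simp only [θ]
      rw [← mul_div_assoc, le_div_iff₀ hp]
      rw [div_le_iff₀ hs] at hm
      nlinarith
  have h3 : (A / δ * ρ) ^ θ' = (A / δ) ^ θ' * ρ ^ θ' := Real.mul_rpow (by positivity) hρ
  have h4 : (δ * (w ^ p * z ^ (2 * (m - 1)))) ^ θ / θ ≤
      (δ * (w ^ p * z ^ (2 * (m - 1)))) ^ θ := div_le_self (by positivity) hθ.lt.le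
  have h5 : (A / δ * ρ) ^ θ' / θ' ≤ (A / δ * ρ) ^ θ' := div_le_self (by positivity) hθ.symm.lt.le
  linarith

/-- A Liouville property: a Caccioppoli type inequality in subcritical dimension has no positive
solution. -/
theorem not_caccioppoli {N : ℕ} {w : Space N → ℝ} (hw : Continuous w) (hpos : ∀ x, 0 < w x)
    {p s C : ℝ} (hp : 0 < p) (hs : 0 < s) (hN : (N : ℝ) < 2 * ((p + s) / s)) :
    ¬ ∀ η : Space N → ℝ, (∃ K, LipschitzWith K η) → HasCompactSupport η →
      ∫ x, w x ^ (p + s) * η x ^ 2 ≤ C * ∫ x, w x ^ p * ‖gradient η x‖ ^ 2 := by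
  intro H
  have hwp : ∀ q : ℝ, Continuous fun x => w x ^ q := fun q =>
    hw.rpow_const fun x => Or.inl (hpos x).ne'
  obtain ⟨m, hm⟩ := exists_nat_ge ((p + s) / s)
  have hm0 : m ≠ 0 := by
    rintro rfl
    have : 0 < (p + s) / s := by positivity
    simp only [Nat.cast_zero] at hm
    linarith
  -- The factor `m²` comes from the gradient of the `m`-th power of the cutoff; `C` has no assumed
  -- sign.
  set A := max C 0 * (m : ℝ) ^ 2 with hA
  obtain ⟨B, hB0, hB⟩ := exists_young_bound hp hs (by positivity : 0 ≤ A) hm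
  have hηc : ∀ R : ℝ, 0 < R → HasCompactSupport fun x => cutoff N R x ^ m := fun R hR =>
    (hasCompactSupport_cutoff hR).comp_left (g := fun t : ℝ => t ^ m) (zero_pow hm0)
  have hηcont : ∀ R : ℝ, 0 < R → Continuous fun x => cutoff N R x ^ m := fun R hR =>
    (lipschitzWith_cutoff hR).continuous.pow m
  have hη2c : ∀ R : ℝ, 0 < R → HasCompactSupport fun x => (cutoff N R x ^ m) ^ 2 :=
    fun R hR => (hηc R hR).comp_left (g := fun t : ℝ => t ^ 2) (zero_pow two_ne_zero)
  have hIint : ∀ R : ℝ, 0 < R →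
      Integrable (fun x => w x ^ (p + s) * (cutoff N R x ^ m) ^ 2) volume := fun R hR =>
    ((hwp _).mul ((hηcont R hR).pow 2)).integrable_of_hasCompactSupport
      (hη2c R hR).mul_left
  set I : ℝ → ℝ := fun R => ∫ x, w x ^ (p + s) * (cutoff N R x ^ m) ^ 2
  have hI1 : 0 < I 1 := by
    refine Continuous.integral_pos_of_hasCompactSupport_nonneg_nonzero (x := 0)
      ((hwp _).mul ((hηcont 1 one_pos).pow 2)) (hη2c 1 one_pos).mul_left
      (fun x => ?_) ?_
    · exact mul_nonneg (Real.rpow_nonneg (hpos x).le _) (sq_nonneg _)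
    · simp only [cutoff_zero, one_pow, mul_one]
      exact (Real.rpow_pos_of_pos (hpos 0) _).ne'
  set V := volume.real (Metric.ball (0 : Space N) 1)
  -- The power of `R` is the volume factor `R^N` times `(R⁻²)^((p+s)/s)`, the remainder in Young's
  -- inequality; by `hN` the exponent is negative.
  have hmain : ∀ R : ℝ, 1 ≤ R → I 1 ≤
      2 * (B * 2 ^ N * V) * R ^ ((N : ℝ) - 2 * ((p + s) / s)) := fun R hR1 => by
    have hR : 0 < R := by linarith
    have hmono : I 1 ≤ I R := by
      refine integral_mono (hIint 1 one_pos) (hIint R hR) fun x => ?_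
      refine mul_le_mul_of_nonneg_left ?_ (Real.rpow_nonneg (hpos x).le _)
      exact pow_le_pow_left₀ (pow_nonneg (cutoff_nonneg _ _) _)
        (pow_le_pow_left₀ (cutoff_nonneg _ _) (cutoff_mono hR1 x) _) _
    obtain ⟨K, hK⟩ := exists_lipschitzWith_cutoff_pow (N := N) hR m
    have hcac := H _ ⟨K, hK⟩ (hηc R hR)
    set b : Space N → ℝ := (Metric.closedBall (0 : Space N) (2 * R)).indicator
      fun _ => B * (R⁻¹ ^ 2) ^ ((p + s) / s) with hb
    have hbi : Integrable b volume :=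
      (integrable_indicator_iff measurableSet_closedBall).2
        (integrableOn_const (isCompact_closedBall _ _).measure_lt_top.ne)
    have hts : (tsupport fun y => cutoff N R y ^ m) ⊆ tsupport (cutoff N R) :=
      closure_mono fun x hx h => hx (by simp only [h, zero_pow hm0])
    have hpt : ∀ᵐ x, max C 0 * (w x ^ p * ‖gradient (fun y => cutoff N R y ^ m) x‖ ^ 2) ≤
        1 / 2 * (w x ^ (p + s) * (cutoff N R x ^ m) ^ 2) + b x := by
      filter_upwards [(lipschitzWith_cutoff (N := N) hR).ae_differentiableAt] with x hx
      by_cases hxs : x ∈ Metric.closedBall (0 : Space N) (2 * R)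
      · have hg : ‖gradient (fun y => cutoff N R y ^ m) x‖ ≤
            m * cutoff N R x ^ (m - 1) * R⁻¹ := by
          rw [gradient_comp (g := fun t => t ^ m) (by fun_prop) hx, norm_smul]
          refine mul_le_mul (le_of_eq ?_) ?_ (norm_nonneg _)
            (mul_nonneg m.cast_nonneg (pow_nonneg (cutoff_nonneg _ _) _))
          · rw [deriv_pow_field, Real.norm_of_nonneg
              (mul_nonneg m.cast_nonneg (pow_nonneg (cutoff_nonneg _ _) _))]
          · refine (norm_gradient_le (lipschitzWith_cutoff hR) x).trans (le_of_eq ?_)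
            exact Real.coe_toNNReal _ (by positivity)
        have hg2 := pow_le_pow_left₀ (norm_nonneg _) hg 2
        have h1 := hB (w x) (cutoff N R x) (R⁻¹ ^ 2) (hpos x) (cutoff_nonneg _ _)
          (cutoff_le_one _ _) (by positivity)
        rw [hb, Set.indicator_of_mem hxs, ← pow_mul, mul_comm m 2]
        refine le_trans ?_ h1
        have h2 : A * R⁻¹ ^ 2 * (w x ^ p * cutoff N R x ^ (2 * (m - 1))) =
            max C 0 * (w x ^ p * (m * cutoff N R x ^ (m - 1) * R⁻¹) ^ 2) := by
          rw [hA, mul_comm 2 (m - 1), pow_mul]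
          ring
        rw [h2]
        exact mul_le_mul_of_nonneg_left
          (mul_le_mul_of_nonneg_left hg2 (Real.rpow_nonneg (hpos x).le _)) (le_max_right _ _)
      · have h1 : x ∉ tsupport fun y => cutoff N R y ^ m := fun h => hxs
          (tsupport_cutoff_subset hR (hts h))
        rw [gradient_eq_zero h1, hb, Set.indicator_of_notMem hxs,
          image_eq_zero_of_notMem_tsupport h1]
        simp
    have hgi : Integrable
        (fun x => w x ^ p * ‖gradient (fun y => cutoff N R y ^ m) x‖ ^ 2) volume := by
      obtain ⟨D, hD⟩ := (hηc R hR).isCompact.exists_bound_of_continuousOn (hwp p).continuousOn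
      refine integrable_of_bound_on_compact (hηc R hR) (D * K ^ 2)
        ((hwp p).measurable.mul ((measurable_gradient _).norm.pow_const 2)).aestronglyMeasurable
        (fun x hx => ?_) (fun x hx => by simp [gradient_eq_zero hx])
      rw [norm_mul, norm_pow, norm_norm]
      exact mul_le_mul (hD x hx) (pow_le_pow_left₀ (norm_nonneg _) (norm_gradient_le hK x) 2)
        (by positivity) ((norm_nonneg _).trans (hD x hx))
    have hint := integral_mono_ae (hgi.const_mul _) (((hIint R hR).const_mul _).add hbi) hpt
    rw [integral_add' ((hIint R hR).const_mul _) hbi, integral_const_mul,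
      integral_const_mul] at hint
    have hCle : C * ∫ x, w x ^ p * ‖gradient (fun y => cutoff N R y ^ m) x‖ ^ 2 ≤
        max C 0 * ∫ x, w x ^ p * ‖gradient (fun y => cutoff N R y ^ m) x‖ ^ 2 :=
      mul_le_mul_of_nonneg_right (le_max_left _ _) (integral_nonneg fun x =>
        mul_nonneg (Real.rpow_nonneg (hpos x).le _) (sq_nonneg _))
    have hbint : ∫ x, b x = B * 2 ^ N * V * R ^ ((N : ℝ) - 2 * ((p + s) / s)) := by
      rw [hb, integral_indicator_const _ measurableSet_closedBall,
        Measure.addHaar_real_closedBall _ _ (by positivity), finrank_euclideanSpace_fin,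
        Real.rpow_sub hR, Real.rpow_natCast, Real.rpow_mul hR.le, inv_pow,
        Real.inv_rpow (by positivity), Real.rpow_two, smul_eq_mul]
      ring
    have hIR : I R ≤ 1 / 2 * I R + ∫ x, b x := hcac.trans (hCle.trans hint)
    rw [hbint] at hIR
    linarith
  have hlim : Tendsto (fun R : ℝ => 2 * (B * 2 ^ N * V) * R ^ ((N : ℝ) - 2 * ((p + s) / s)))
      atTop (𝓝 0) := by
    have h := (tendsto_rpow_neg_atTop
      (y := 2 * ((p + s) / s) - N) (by linarith)).const_mul (2 * (B * 2 ^ N * V))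
    simpa using h
  have := ge_of_tendsto hlim (eventually_atTop.2 ⟨1, hmain⟩)
  linarith

/-! ### Differential inequalities for `f` derived from the limit of `q`. -/

/-- Near `0`, bounds on the limit of `q` give differential inequalities for `f`. -/
theorem exists_forall_le_of_tendsto_q {f : ℝ → ℝ} {r q₁ q₂ : ℝ}
    (hlim : Tendsto (q f) (𝓝[>] (0 : ℝ)) (𝓝 (r : EReal)))
    (hpos : ∀ t, 0 < t → 0 < f t) (hdd0 : ∀ t, 0 < t → 0 ≤ deriv (deriv f) t)
    (h1 : q₁ < r) (h2 : r < q₂) :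
    ∃ ε, 0 < ε ∧ ∀ t, 0 < t → t ≤ ε → 0 < deriv (deriv f) t ∧
      q₁ * (f t * deriv (deriv f) t) ≤ deriv f t ^ 2 ∧
      deriv f t ^ 2 ≤ q₂ * (f t * deriv (deriv f) t) := by
  have hev : ∀ᶠ t in 𝓝[>] (0 : ℝ), q f t ∈ Set.Ioo (q₁ : EReal) (q₂ : EReal) :=
    hlim.eventually (Ioo_mem_nhds (by exact_mod_cast h1) (by exact_mod_cast h2))
  obtain ⟨b, hb, hbs⟩ := (mem_nhdsGT_iff_exists_Ioc_subset).1 hev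
  refine ⟨b, hb, fun t ht htb => ?_⟩
  obtain ⟨hq1, hq2⟩ := hbs ⟨ht, htb⟩
  by_cases h : f t * deriv (deriv f) t ≠ 0
  · have hp : 0 < f t * deriv (deriv f) t :=
      lt_of_le_of_ne (mul_nonneg (hpos t ht).le (hdd0 t ht)) h.symm
    simp only [q, if_pos h, EReal.coe_lt_coe_iff] at hq1 hq2
    rw [lt_div_iff₀ hp] at hq1
    rw [div_lt_iff₀ hp] at hq2
    exact ⟨pos_of_mul_pos_right hp (hpos t ht).le, hq1.le, hq2.le⟩
  · rw [q, if_neg h] at hq2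
    exact absurd hq2 not_top_lt

/-- If `q₁ f f'' ≤ f'²` near `0`, then `f'` is bounded below by a multiple of `f ^ (1 / q₁)`. -/
theorem exists_rpow_le_deriv {f : ℝ → ℝ} {q₁ ε M : ℝ} (hpos : ∀ t, 0 < t → 0 < f t)
    (hd : ∀ t, 0 < t → HasDerivAt f (deriv f t) t)
    (hdd : ∀ t, 0 < t → HasDerivAt (deriv f) (deriv (deriv f) t) t)
    (hf' : ∀ t, 0 < t → 0 < deriv f t)
    (hmono' : MonotoneOn (deriv f) (Set.Ioi 0)) (hq : 0 < q₁) (hε : 0 < ε)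
    (hle : ∀ t, 0 < t → t ≤ ε → q₁ * (f t * deriv (deriv f) t) ≤ deriv f t ^ 2) :
    ∃ c, 0 < c ∧ ∀ t, 0 < t → t ≤ M → c * f t ^ (1 / q₁) ≤ deriv f t := by
  -- `g'` has the sign of `q₁ f f'' - f'²`, so `g` decreases on `(0, ε]` and is at least `g ε`
  -- there. Beyond `ε` the bound uses only the monotonicity of `f` and `f'`.
  set g : ℝ → ℝ := fun t => deriv f t * f t ^ (-(1 / q₁)) with hg
  have hmono : ∀ x y, 0 < x → x ≤ y → f x ≤ f y := fun x y hx hxy => by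
    have : MonotoneOn f (Set.Ioi 0) :=
      monotoneOn_of_deriv_nonneg (convex_Ioi 0)
        (fun t ht => (hd t ht).continuousAt.continuousWithinAt)
        (fun t ht => (hd t (by simpa using ht)).differentiableAt.differentiableWithinAt)
        fun t ht => (hf' t (by simpa using ht)).le
    exact this hx (hx.trans_le hxy) hxy
  have hgd : ∀ t, 0 < t → HasDerivAt g (deriv (deriv f) t * f t ^ (-(1 / q₁)) +
      deriv f t * (deriv f t * (-(1 / q₁)) * f t ^ (-(1 / q₁) - 1))) t := fun t ht =>
    (hdd t ht).mul ((hd t ht).rpow_const (Or.inl (hpos t ht).ne'))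
  have hganti : AntitoneOn g (Set.Ioc 0 ε) := by
    refine antitoneOn_of_deriv_nonpos (convex_Ioc 0 ε)
      (fun t ht => (hgd t ht.1).continuousAt.continuousWithinAt)
      (fun t ht => (hgd t (interior_subset ht).1).differentiableAt.differentiableWithinAt)
      fun t ht => ?_
    have ht' := interior_subset ht
    rw [(hgd t ht'.1).deriv]
    have hft := hpos t ht'.1
    have h1 : f t ^ (-(1 / q₁)) = f t * f t ^ (-(1 / q₁) - 1) := by
      rw [Real.rpow_sub_one hft.ne']
      field_simp
    have h2 := hle t ht'.1 ht'.2
    have h3 : deriv (deriv f) t * f t ^ (-(1 / q₁)) +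
        deriv f t * (deriv f t * (-(1 / q₁)) * f t ^ (-(1 / q₁) - 1)) =
        (q₁ * (f t * deriv (deriv f) t) - deriv f t ^ 2) / q₁ * f t ^ (-(1 / q₁) - 1) := by
      rw [h1]
      field_simp
      ring
    rw [h3]
    exact mul_nonpos_of_nonpos_of_nonneg (div_nonpos_of_nonpos_of_nonneg (by linarith) hq.le)
      (Real.rpow_nonneg hft.le _)
  have hgε : 0 < g ε := mul_pos (hf' ε hε) (Real.rpow_pos_of_pos (hpos ε hε) _)
  have hM : 0 < max M ε := lt_max_of_lt_right hε
  have hfM : 0 < f (max M ε) ^ (1 / q₁) := Real.rpow_pos_of_pos (hpos _ hM) _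
  refine ⟨min (g ε) (deriv f ε / f (max M ε) ^ (1 / q₁)),
    lt_min hgε (div_pos (hf' ε hε) hfM), fun t ht htM => ?_⟩
  have hft := hpos t ht
  have hftq : 0 < f t ^ (1 / q₁) := Real.rpow_pos_of_pos hft _
  rcases le_total t ε with h | h
  · have h1 := hganti ⟨ht, h⟩ ⟨hε, le_rfl⟩ h
    calc _ ≤ g t * f t ^ (1 / q₁) :=
          mul_le_mul_of_nonneg_right ((min_le_left _ _).trans h1) hftq.le
      _ = deriv f t := by
          simp only [hg]
          rw [mul_assoc, ← Real.rpow_add hft, neg_add_cancel, Real.rpow_zero, mul_one]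
  · calc _ ≤ deriv f ε / f (max M ε) ^ (1 / q₁) * f (max M ε) ^ (1 / q₁) := by
          refine mul_le_mul (min_le_right _ _) ?_ hftq.le (div_pos (hf' ε hε) hfM).le
          exact Real.rpow_le_rpow hft.le (hmono _ _ ht (htM.trans (le_max_left _ _)))
            (by positivity)
      _ = deriv f ε := div_mul_cancel₀ _ hfM.ne'
      _ ≤ deriv f t := hmono' hε ht h

/-- If `f(0) = 0`, the ratio `f'² / (f f'')` cannot stay below a constant less than `1`. -/
theorem not_deriv_sq_le {f : ℝ → ℝ} {ε : ℝ} (hf0 : f 0 = 0)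
    (hconv : ConvexOn ℝ (Set.Ici 0) f) (hpos : ∀ t, 0 < t → 0 < f t)
    (hd : ∀ t, 0 < t → HasDerivAt f (deriv f t) t)
    (hdd : ∀ t, 0 < t → HasDerivAt (deriv f) (deriv (deriv f) t) t)
    (hf' : ∀ t, 0 < t → 0 < deriv f t) (hε : 0 < ε) :
    ¬ ∀ t, 0 < t → t ≤ ε → deriv f t ^ 2 ≤ f t * deriv (deriv f) t := by
  intro hle
  -- Here `h' = 1 - f f'' / f'² ≤ 0`, so the positive function `h` cannot tend to `0` at `0`; but
  -- convexity and `f 0 = 0` give `h t ≤ t`.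
  set h : ℝ → ℝ := fun t => f t / deriv f t
  have hhd : ∀ t, 0 < t → HasDerivAt h
      ((deriv f t * deriv f t - f t * deriv (deriv f) t) / deriv f t ^ 2) t := fun t ht =>
    (hd t ht).div (hdd t ht) (hf' t ht).ne'
  have hanti : AntitoneOn h (Set.Ioc 0 ε) := by
    refine antitoneOn_of_deriv_nonpos (convex_Ioc 0 ε)
      (fun t ht => (hhd t ht.1).continuousAt.continuousWithinAt)
      (fun t ht => (hhd t (interior_subset ht).1).differentiableAt.differentiableWithinAt)
      fun t ht => ?_
    have ht' := interior_subset ht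
    rw [(hhd t ht'.1).deriv]
    exact div_nonpos_of_nonpos_of_nonneg (by nlinarith [hle t ht'.1 ht'.2]) (sq_nonneg _)
  have hhle : ∀ t, 0 < t → h t ≤ t := fun t ht => by
    have := hconv.slope_le_deriv (Set.mem_Ici.2 le_rfl) (Set.mem_Ici.2 ht.le) ht
      (hd t ht).differentiableAt
    rw [slope_def_field, hf0, sub_zero, sub_zero, div_le_iff₀ ht] at this
    rw [div_le_iff₀ (hf' t ht)]
    linarith
  have hhε : 0 < h ε := div_pos (hpos ε hε) (hf' ε hε)
  set t := min ε (h ε / 2)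
  have ht : 0 < t := lt_min hε (by linarith)
  have h1 : h ε ≤ h t := hanti ⟨ht, min_le_left _ _⟩ ⟨hε, le_rfl⟩ (min_le_left _ _)
  have h2 : t ≤ h ε / 2 := min_le_right _ _
  linarith [hhle t ht]

/-! ### Test functions built from powers of `f`, continued past `ε`. -/

/-- The continuous function equal to `g₁` before `ε` and to a translate of `g₂` after `ε`. -/
noncomputable def glue (g₁ g₂ : ℝ → ℝ) (ε t : ℝ) : ℝ := g₁ (min t ε) + (g₂ (max t ε) - g₂ ε)

theorem glue_of_le {g₁ g₂ : ℝ → ℝ} {ε t : ℝ} (h : t ≤ ε) : glue g₁ g₂ ε t = g₁ t := by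
  simp [glue, h]

theorem glue_of_ge {g₁ g₂ : ℝ → ℝ} {ε t : ℝ} (h : ε ≤ t) :
    glue g₁ g₂ ε t = g₁ ε + (g₂ t - g₂ ε) := by
  simp [glue, h]

theorem hasDerivAt_glue_of_lt {g₁ g₂ : ℝ → ℝ} {ε t d : ℝ} (h : t < ε) (hd : HasDerivAt g₁ d t) :
    HasDerivAt (glue g₁ g₂ ε) d t :=
  hd.congr_of_eventuallyEq (by
    filter_upwards [Iio_mem_nhds h] with s hs using glue_of_le (Set.mem_Iio.1 hs).le)

theorem hasDerivAt_glue_of_gt {g₁ g₂ : ℝ → ℝ} {ε t d : ℝ} (h : ε < t) (hd : HasDerivAt g₂ d t) :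
    HasDerivAt (glue g₁ g₂ ε) d t :=
  ((hd.sub_const (g₂ ε)).const_add (g₁ ε)).congr_of_eventuallyEq (by
    filter_upwards [Ioi_mem_nhds h] with s hs using glue_of_ge (Set.mem_Ioi.1 hs).le)

theorem exists_lipschitzOnWith_Icc {g : ℝ → ℝ} (hg : ∀ t, 0 < t → ContDiffAt ℝ 1 g t) {m M : ℝ}
    (hm : 0 < m) : ∃ K, LipschitzOnWith K g (Set.Icc m M) := by
  have h : ContDiffOn ℝ 1 g (Set.Icc m M) := fun t ht =>
    (hg t (hm.trans_le ht.1)).contDiffWithinAt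
  exact h.exists_lipschitzOnWith one_ne_zero (convex_Icc m M) isCompact_Icc

/-- Truncation by `min` and `max` is 1-Lipschitz, so the corner at `ε` does no harm. -/
theorem exists_lipschitzOnWith_glue {g₁ g₂ : ℝ → ℝ} (h₁ : ∀ t, 0 < t → ContDiffAt ℝ 1 g₁ t)
    (h₂ : ∀ t, 0 < t → ContDiffAt ℝ 1 g₂ t) {ε m M : ℝ} (hε : 0 < ε) (hm : 0 < m) :
    ∃ K, LipschitzOnWith K (glue g₁ g₂ ε) (Set.Icc m M) := by
  obtain ⟨K₁, hK₁⟩ := exists_lipschitzOnWith_Icc h₁ (M := max M ε) (lt_min hm hε)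
  obtain ⟨K₂, hK₂⟩ := exists_lipschitzOnWith_Icc h₂ (M := max M ε) (lt_min hm hε)
  have e₁ := hK₁.comp ((LipschitzWith.id.min_const ε).lipschitzOnWith (s := Set.Icc m M))
    fun t ht => ⟨min_le_min_right ε ht.1,
      (min_le_left _ _).trans (ht.2.trans (le_max_left _ _))⟩
  have e₂ := hK₂.comp ((LipschitzWith.id.max_const ε).lipschitzOnWith (s := Set.Icc m M))
    fun t ht => ⟨(min_le_left _ _).trans (ht.1.trans (le_max_left _ _)), max_le_max_right ε ht.2⟩
  exact ⟨_, e₁.add (e₂.sub ((LipschitzWith.const (g₂ ε)).lipschitzOnWith))⟩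

/-- Energy estimate for powers of `f`: if `f'² ≤ q₂ f f''` near `0` and `(a - 1)² q₂ < 1`, then
the stability inequality improves to a Caccioppoli inequality for `f ^ a` truncated linearly. -/
theorem exists_energy_estimate_rpow {N : ℕ} {f : ℝ → ℝ} {u : Space N → ℝ} {a q₂ ε M : ℝ}
    (hweak : IsWeakSubsolution f u) (hstab : IsStable f u) (hu : ∀ x, 0 < u x)
    (hM : ∀ x, u x ≤ M) (hε : 0 < ε) (hεM : ε ≤ M) (hεu : ∀ᵐ x, u x ≠ ε)
    (hC1 : ∀ t, 0 < t → ContDiffAt ℝ 1 f t) (hC1' : ∀ t, 0 < t → ContDiffAt ℝ 1 (deriv f) t)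
    (hpos : ∀ t, 0 < t → 0 < f t) (hf' : ∀ t, 0 < t → 0 < deriv f t)
    (hdd0 : ∀ t, 0 < t → 0 ≤ deriv (deriv f) t)
    (hmono' : MonotoneOn (deriv f) (Set.Ioi 0))
    (ha : 1 < a) (hq : 0 < q₂) (haq : (a - 1) ^ 2 * q₂ < 1)
    (hle : ∀ t, 0 < t → t ≤ ε → deriv f t ^ 2 ≤ q₂ * (f t * deriv (deriv f) t)) :
    ∃ (φ : ℝ → ℝ) (C : ℝ), ContinuousOn φ (Set.Ioi 0) ∧ (∀ t, 0 < t → 0 < φ t) ∧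
      (∀ t, 0 < t → φ t ≤ f t ^ a) ∧
      ∀ η : Space N → ℝ, (∃ K, LipschitzWith K η) → HasCompactSupport η →
        ∫ x, deriv f (u x) * φ (u x) ^ 2 * η x ^ 2 ≤
          C * ∫ x, φ (u x) ^ 2 * ‖gradient η x‖ ^ 2 := by
  have hd : ∀ t, 0 < t → HasDerivAt f (deriv f t) t := fun t ht =>
    ((hC1 t ht).differentiableAt one_ne_zero).hasDerivAt
  have hdd : ∀ t, 0 < t → HasDerivAt (deriv f) (deriv (deriv f) t) t := fun t ht =>
    ((hC1' t ht).differentiableAt one_ne_zero).hasDerivAt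
  have hmono : ∀ x y, 0 < x → x ≤ y → f x ≤ f y := fun x y hx hxy => by
    have : MonotoneOn f (Set.Ioi 0) :=
      monotoneOn_of_deriv_nonneg (convex_Ioi 0)
        (fun t ht => (hd t ht).continuousAt.continuousWithinAt)
        (fun t ht => (hd t (by simpa using ht)).differentiableAt.differentiableWithinAt)
        fun t ht => (hf' t (by simpa using ht)).le
    exact this hx (hx.trans_le hxy) hxy
  have hfm : ∀ x y, 0 < x → x ≤ y → f x * deriv f x ≤ f y * deriv f y := fun x y hx hxy =>
    mul_le_mul (hmono x y hx hxy) (hmono' hx (hx.trans_le hxy) hxy) (hf' x hx).le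
      (hpos y (hx.trans_le hxy)).le
  have hden : 0 < 2 * a - 1 + 1 / q₂ := by
    have : 0 < 1 / q₂ := by positivity
    linarith
  -- Below `ε`, `ψ' = κ f^(2a-2) ((2a - 1) f'² + f f'')`, and `f f'' ≥ f'² / q₂`; this `κ` makes the
  -- resulting lower bound exactly `φ'² = a² f^(2a-2) f'²`. Moreover `κ < 1` amounts to `(a - 1)² q₂
  -- < 1`.
  set κ := a ^ 2 / (2 * a - 1 + 1 / q₂) with hκ
  have hκ0 : 0 < κ := by positivity
  have hκ1 : κ < 1 := by
    rw [hκ, div_lt_one hden]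
    have : (a - 1) ^ 2 < 1 / q₂ := by rwa [lt_div_iff₀ hq]
    nlinarith
  have hκa : κ * (2 * a - 1 + 1 / q₂) = a ^ 2 := div_mul_cancel₀ _ hden.ne'
  -- This makes `A f` agree with `f^a` at `ε`. Beyond `ε`, `ψ' = A² (f'² + f f'') ≥ φ'²` needs only
  -- convexity.
  set A := f ε ^ (a - 1) with hA
  have hfε := hpos ε hε
  have hA0 : 0 < A := Real.rpow_pos_of_pos hfε _
  have hAε : f ε ^ a = A * f ε := by
    rw [hA, Real.rpow_sub_one hfε.ne']
    field_simp
  have hAε2 : f ε ^ (2 * a - 1) = A ^ 2 * f ε := by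
    rw [hA, ← Real.rpow_natCast, ← Real.rpow_mul hfε.le, ← Real.rpow_add_one hfε.ne']
    congr 1
    push_cast
    ring
  set φ₁ : ℝ → ℝ := fun t => f t ^ a
  set φ₂ : ℝ → ℝ := fun t => A * f t
  set ψ₁ : ℝ → ℝ := fun t => κ * f t ^ (2 * a - 1) * deriv f t
  set ψ₂ : ℝ → ℝ := fun t => A ^ 2 * (f t * deriv f t)
  have c1 : ∀ t, 0 < t → ContDiffAt ℝ 1 φ₁ t := fun t ht =>
    (hC1 t ht).rpow_const_of_ne (hpos t ht).ne'
  have c2 : ∀ t, 0 < t → ContDiffAt ℝ 1 φ₂ t := fun t ht => contDiffAt_const.mul (hC1 t ht)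
  have c3 : ∀ t, 0 < t → ContDiffAt ℝ 1 ψ₁ t := fun t ht =>
    (contDiffAt_const.mul ((hC1 t ht).rpow_const_of_ne (hpos t ht).ne')).mul (hC1' t ht)
  have c4 : ∀ t, 0 < t → ContDiffAt ℝ 1 ψ₂ t := fun t ht =>
    contDiffAt_const.mul ((hC1 t ht).mul (hC1' t ht))
  set φ := glue φ₁ φ₂ ε
  set ψ := glue ψ₁ ψ₂ ε
  have φle : ∀ t, t ≤ ε → φ t = f t ^ a := fun t ht => glue_of_le ht
  have φge : ∀ t, ε ≤ t → φ t = A * f t := fun t ht => by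
    rw [show φ t = φ₁ ε + (φ₂ t - φ₂ ε) from glue_of_ge ht]
    simp only [φ₁, φ₂, hAε]
    ring
  have ψle : ∀ t, t ≤ ε → ψ t = κ * f t ^ (2 * a - 1) * deriv f t := fun t ht => glue_of_le ht
  have ψge : ∀ t, ε ≤ t →
      ψ t = A ^ 2 * (f t * deriv f t - (1 - κ) * (f ε * deriv f ε)) := fun t ht => by
    rw [show ψ t = ψ₁ ε + (ψ₂ t - ψ₂ ε) from glue_of_ge ht]
    simp only [ψ₁, ψ₂, hAε2]
    ring
  have dφlt : ∀ t, 0 < t → t < ε → HasDerivAt φ (deriv f t * a * f t ^ (a - 1)) t :=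
    fun t ht h => hasDerivAt_glue_of_lt h ((hd t ht).rpow_const (Or.inl (hpos t ht).ne'))
  have dφgt : ∀ t, 0 < t → ε < t → HasDerivAt φ (A * deriv f t) t :=
    fun t ht h => hasDerivAt_glue_of_gt h ((hd t ht).const_mul A)
  have dψlt : ∀ t, 0 < t → t < ε → HasDerivAt ψ
      (κ * (deriv f t * (2 * a - 1) * f t ^ (2 * a - 1 - 1)) * deriv f t +
        κ * f t ^ (2 * a - 1) * deriv (deriv f) t) t :=
    fun t ht h => hasDerivAt_glue_of_lt h
      ((((hd t ht).rpow_const (Or.inl (hpos t ht).ne')).const_mul κ).mul (hdd t ht))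
  have dψgt : ∀ t, 0 < t → ε < t → HasDerivAt ψ
      (A ^ 2 * (deriv f t * deriv f t + f t * deriv (deriv f) t)) t :=
    fun t ht h => hasDerivAt_glue_of_gt h (((hd t ht).mul (hdd t ht)).const_mul _)
  have r1 : ∀ t, 0 < t → f t ^ (2 * a - 1) = f t ^ a * f t ^ (a - 1) := fun t ht => by
    rw [← Real.rpow_add (hpos t ht)]
    congr 1
    ring
  have r2 : ∀ t, 0 < t → f t ^ (2 * a - 1 - 1) = (f t ^ (a - 1)) ^ 2 := fun t ht => by
    rw [← Real.rpow_natCast, ← Real.rpow_mul (hpos t ht).le]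
    congr 1
    push_cast
    ring
  have r3 : ∀ t, 0 < t → f t ^ a = f t ^ (a - 1) * f t := fun t ht => by
    rw [← Real.rpow_add_one (hpos t ht).ne']
    congr 1
    ring
  have hG : ∀ t, 0 < t → 0 < f t ^ (a - 1) := fun t ht => Real.rpow_pos_of_pos (hpos t ht) _
  have hφpos : ∀ t, 0 < t → 0 < φ t := fun t ht => by
    rcases le_total t ε with h | h
    · rw [φle t h]
      exact Real.rpow_pos_of_pos (hpos t ht) _
    · rw [φge t h]
      exact mul_pos hA0 (hpos t ht)
  have hM0 : 0 < M := hε.trans_le hεM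
  have hEM : 0 < f M * deriv f M := mul_pos (hpos M hM0) (hf' M hM0)
  have hEε : 0 < f ε * deriv f ε := mul_pos hfε (hf' ε hε)
  -- Beyond `ε` the jump from `κ` to 1 leaves `f ψ` below `f' φ²` by `A² (1 - κ) f(ε) f'(ε) f`;
  -- since `f f'` is at most its value at `M`, this is at least the proportion `c` of `f' φ²`.
  set c := (1 - κ) * (f ε * deriv f ε) / (f M * deriv f M) with hc
  have hcM : c * (f M * deriv f M) = (1 - κ) * (f ε * deriv f ε) := div_mul_cancel₀ _ hEM.ne'
  have hc0 : 0 < c := div_pos (mul_pos (by linarith) hEε) hEM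
  have hcκ : c ≤ 1 - κ := by
    rw [hc, div_le_iff₀ hEM]
    exact mul_le_mul_of_nonneg_left (hfm ε M hε hεM) (by linarith)
  have hcontu : Continuous u := hweak.1.continuous
  have hcomp : ∀ g : ℝ → ℝ, (∀ t, 0 < t → ContDiffAt ℝ 1 g t) → Continuous fun x => g (u x) :=
    fun g hg => continuous_iff_continuousAt.2 fun x =>
      ContinuousAt.comp (f := u) (hg _ (hu x)).continuousAt hcontu.continuousAt
  suffices H : ∃ C, ∀ η : Space N → ℝ, (∃ K, LipschitzWith K η) → HasCompactSupport η →
      ∫ x, deriv f (u x) * φ (u x) ^ 2 * η x ^ 2 ≤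
        C * ∫ x, φ (u x) ^ 2 * ‖gradient η x‖ ^ 2 by
    obtain ⟨C, hC⟩ := H
    refine ⟨φ, C, fun t ht => ?_, hφpos, fun t ht => ?_, hC⟩
    · have ht' : 0 < t := ht
      obtain ⟨K, hK⟩ := exists_lipschitzOnWith_glue c1 c2 hε (M := t + 1) (half_pos ht')
      exact (hK.continuousOn.continuousAt
        (Icc_mem_nhds (by linarith) (by linarith))).continuousWithinAt
    · rcases le_total t ε with h | h
      · exact (φle t h).le
      · rw [φge t h, r3 t ht]
        exact mul_le_mul_of_nonneg_right
          (Real.rpow_le_rpow hfε.le (hmono ε t hε h) (by linarith)) (hpos t ht).le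
  refine energy_estimate (φ := φ) (ψ := ψ) hweak hstab hu hM (hcomp f hC1)
    (hcomp _ hC1') hεu hc0 (fun m hm => exists_lipschitzOnWith_glue c1 c2 hε hm)
    (fun m hm => exists_lipschitzOnWith_glue c3 c4 hε hm) (fun t ht => (hφpos t ht).le)
    (fun t ht => ?_) (fun t ht hne => ?_) (fun t ht hne => ?_) (fun t ht hne => ?_)
    (fun t ht hne => ?_) (fun t ht hne => ?_) (fun t ht htM => ?_)
  · rcases le_total t ε with h | h
    · rw [ψle t h]
      have := Real.rpow_pos_of_pos (hpos t ht) (2 * a - 1)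
      have := hf' t ht
      positivity
    · rw [ψge t h]
      have := hfm ε t hε h
      exact mul_nonneg (sq_nonneg _) (by nlinarith)
  · rcases lt_or_gt_of_ne hne with h | h
    exacts [(dφlt t ht h).differentiableAt, (dφgt t ht h).differentiableAt]
  · rcases lt_or_gt_of_ne hne with h | h
    exacts [(dψlt t ht h).differentiableAt, (dψgt t ht h).differentiableAt]
  · rcases lt_or_gt_of_ne hne with h | h
    · rw [(dφlt t ht h).deriv]
      have := hG t ht
      have := hf' t ht
      positivity
    · rw [(dφgt t ht h).deriv]
      exact (mul_pos hA0 (hf' t ht)).le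
  · rcases lt_or_gt_of_ne hne with h | h
    · rw [(dφlt t ht h).deriv, (dψlt t ht h).deriv, r1 t ht, r2 t ht, r3 t ht]
      set G := f t ^ (a - 1)
      have h1 : deriv f t ^ 2 / q₂ ≤ f t * deriv (deriv f) t := by
        rw [div_le_iff₀ hq]
        linarith [hle t ht h.le]
      calc (deriv f t * a * G) ^ 2 = a ^ 2 * (deriv f t ^ 2 * G ^ 2) := by ring
        _ = κ * (2 * a - 1) * (deriv f t ^ 2 * G ^ 2) + κ * G ^ 2 * (deriv f t ^ 2 / q₂) := by
            rw [← hκa]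
            ring
        _ ≤ κ * (2 * a - 1) * (deriv f t ^ 2 * G ^ 2) +
            κ * G ^ 2 * (f t * deriv (deriv f) t) := by
            gcongr
        _ = _ := by ring
    · rw [(dφgt t ht h).deriv, (dψgt t ht h).deriv, mul_pow]
      have := mul_nonneg (hpos t ht).le (hdd0 t ht)
      exact mul_le_mul_of_nonneg_left (by nlinarith) (sq_nonneg _)
  · rcases lt_or_gt_of_ne hne with h | h
    · rw [(dφlt t ht h).deriv, φle t h.le, ψle t h.le, r1 t ht]
      have h1 : 0 ≤ f t ^ a * f t ^ (a - 1) * deriv f t :=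
        mul_nonneg (mul_nonneg (Real.rpow_nonneg (hpos t ht).le _) (hG t ht).le) (hf' t ht).le
      nlinarith [mul_le_mul_of_nonneg_right (hκ1.le.trans ha.le) h1]
    · rw [(dφgt t ht h).deriv, φge t h.le, ψge t h.le]
      have h1 : 0 ≤ A ^ 2 * ((1 - κ) * (f ε * deriv f ε)) :=
        mul_nonneg (sq_nonneg _) (mul_nonneg (by linarith) hEε.le)
      linarith
  · rcases le_total t ε with h | h
    · rw [φle t h, ψle t h, r1 t ht]
      have h1 : 0 ≤ deriv f t * (f t ^ a) ^ 2 := mul_nonneg (hf' t ht).le (sq_nonneg _)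
      calc f t * (κ * (f t ^ a * f t ^ (a - 1)) * deriv f t)
          = κ * (deriv f t * (f t ^ a * (f t ^ (a - 1) * f t))) := by ring
        _ = κ * (deriv f t * (f t ^ a) ^ 2) := by
            rw [← r3 t ht]
            ring
        _ ≤ _ := mul_le_mul_of_nonneg_right (by linarith) h1
    · rw [φge t h, ψge t h]
      have h1 : c * (f t * deriv f t) ≤ (1 - κ) * (f ε * deriv f ε) := by
        rw [← hcM]
        exact mul_le_mul_of_nonneg_left (hfm t M ht htM) hc0.le
      have h2 : 0 ≤ A ^ 2 * f t := mul_nonneg (sq_nonneg _) (hpos t ht).le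
      nlinarith [mul_le_mul_of_nonneg_left h1 h2]

/-! ### Arithmetic of the exponents and the critical dimension. -/

/-- The dimension condition in terms of the limit `r` of `q` at `0`. -/
theorem dimension_lt {N : ℕ} {r : ℝ} (hr : 1 ≤ r)
    (hN : (1 ≤ N ∧ N ≤ 9) ∨ (N = 10 ∧ conjExponent (r : EReal) < ⊤) ∨
      (11 ≤ N ∧ conjExponent (r : EReal) < (pc N : EReal))) :
    (N : ℝ) < 4 * r + 4 * √r + 2 := by
  have hs1 : 1 ≤ √r := Real.one_le_sqrt.2 hr
  have hlt : ∀ x : EReal, conjExponent (r : EReal) < x → 1 < r := fun x hx => by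
    refine lt_of_le_of_ne hr fun h => ?_
    rw [← h] at hx
    simp [conjExponent] at hx
  rcases hN with ⟨-, h9⟩ | ⟨rfl, hlt10⟩ | ⟨h11, hpc⟩
  · have : (N : ℝ) ≤ 9 := by exact_mod_cast h9
    linarith
  · have := hlt _ hlt10
    push_cast
    linarith
  · have hr1 := hlt _ hpc
    have hne : (r : EReal) ≠ 1 := by exact_mod_cast hr1.ne'
    rw [conjExponent, if_neg hne, if_neg (EReal.coe_ne_top r), EReal.coe_lt_coe_iff,
      EReal.toReal_coe] at hpc
    have hN11 : (11 : ℝ) ≤ N := by exact_mod_cast h11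
    set s := √((N : ℝ) - 1) with hs
    have hss : s ^ 2 = N - 1 := Real.sq_sqrt (by linarith)
    have hs3 : 3 < s := by
      rw [hs]
      exact Real.lt_sqrt_of_sq_lt (by linarith)
    -- In this form `pc N` is the conjugate exponent of `((s - 1) / 2)²`. The goal reads `s² + 1 <
    -- (2 √r + 1)² + 1`, that is `(s - 1) / 2 < √r`.
    have hpcs : pc N = (s - 1) ^ 2 / ((s - 3) * (s + 1)) := by
      have hNs : (N : ℝ) = s ^ 2 + 1 := by linarith
      have h1 : 0 < s ^ 2 - 1 := by nlinarith
      have h2 : 0 < s ^ 2 - 9 := by nlinarith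
      have h3 : 0 < (s - 3) * (s + 1) := mul_pos (by linarith) (by linarith)
      rw [pc, ← hs, hNs, div_eq_div_iff]
      · ring
      · have : 0 < (s ^ 2 + 1 - 2) * (s ^ 2 + 1 - 10) := mul_pos (by linarith) (by linarith)
        exact this.ne'
      · exact h3.ne'
    rw [hpcs, div_lt_div_iff₀ (by linarith) (mul_pos (by linarith) (by linarith))] at hpc
    have h4 : ((s - 1) / 2) ^ 2 < r := by nlinarith
    have h5 : (s - 1) / 2 < √r := Real.lt_sqrt_of_sq_lt h4
    nlinarith

/-- Choice of the exponents. -/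
theorem exists_exponents {r D : ℝ} (hr : 1 ≤ r) (hD : D < 4 * r + 4 * √r + 2) :
    ∃ a q₁ q₂ : ℝ, 1 < a ∧ 0 < q₁ ∧ q₁ < r ∧ r < q₂ ∧ D < 4 * a * q₁ + 2 ∧
      (a - 1) ^ 2 * q₂ < 1 := by
  have hr0 : 0 < r := by linarith
  have hs : 0 < √r := Real.sqrt_pos.2 hr0
  have hss : √r * √r = r := Real.mul_self_sqrt hr0.le
  -- The upper bound on `a` is `(a - 1)² r < 1`; at that endpoint `4 a r + 2 = 4 r + 4 √r + 2`. All
  -- inequalities are strict, leaving room for `q₁ < r < q₂`.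
  obtain ⟨a, ha, ha2⟩ : ∃ a, max 1 ((D - 2) / (4 * r)) < a ∧ a < 1 + 1 / √r := by
    refine exists_between (max_lt (by linarith [one_div_pos.2 hs]) ?_)
    rw [div_lt_iff₀ (by positivity)]
    have : (1 + 1 / √r) * (4 * r) = 4 * r + 4 * √r := by
      have : 1 / √r * r = √r := by
        rw [one_div, inv_mul_eq_div, Real.div_sqrt]
      linarith
    linarith
  have ha1 : 1 < a := (le_max_left _ _).trans_lt ha
  have haD : (D - 2) / (4 * r) < a := (le_max_right _ _).trans_lt ha
  rw [div_lt_iff₀ (by positivity)] at haD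
  obtain ⟨q₁, h1, h1r⟩ : ∃ q₁, max 0 ((D - 2) / (4 * a)) < q₁ ∧ q₁ < r := by
    refine exists_between (max_lt hr0 ?_)
    rw [div_lt_iff₀ (by linarith)]
    linarith
  have h10 : 0 < q₁ := (le_max_left _ _).trans_lt h1
  have h1D : (D - 2) / (4 * a) < q₁ := (le_max_right _ _).trans_lt h1
  rw [div_lt_iff₀ (by linarith)] at h1D
  have ha3 : 0 < (a - 1) ^ 2 := pow_pos (by linarith) 2
  obtain ⟨q₂, h2, h2a⟩ : ∃ q₂, r < q₂ ∧ q₂ < 1 / (a - 1) ^ 2 := by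
    refine exists_between ?_
    rw [lt_div_iff₀ ha3]
    have h3 : (a - 1) * √r < 1 := by
      rw [← lt_div_iff₀ hs]
      linarith
    have h4 : 0 < (a - 1) * √r := mul_pos (by linarith) hs
    nlinarith
  rw [lt_div_iff₀ ha3] at h2a
  exact ⟨a, q₁, q₂, ha1, h10, h1r, h2, by linarith, by linarith⟩

/-! ### Conclusion of the proof. -/

/-- Nonexistence of stable bounded positive weak subsolutions. -/
theorem not_exists_stable_weakSubsolution (f : ℝ → ℝ)
    (hf : ContDiffOn ℝ 2 f (Set.Ici 0))
    (hmono : MonotoneOn f (Set.Ici 0))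
    (hconv : ConvexOn ℝ (Set.Ici 0) f)
    (hpos : ∀ t : ℝ, 0 < t → 0 < f t)
    (q₀ : EReal)
    (hlim : Tendsto (q f) (𝓝[>] (0 : ℝ)) (𝓝 q₀))
    (hq₀ : 0 < q₀) (hq₀' : q₀ < ⊤)
    (N : ℕ)
    (hN : (1 ≤ N ∧ N ≤ 9) ∨ (N = 10 ∧ conjExponent q₀ < ⊤) ∨
      (11 ≤ N ∧ conjExponent q₀ < (pc N : EReal))) :
    ¬ ∃ u : Space N → ℝ, IsWeakSubsolution f u ∧ (∃ M : ℝ, ∀ x, |u x| ≤ M) ∧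
        (∀ x, 0 < u x) ∧ IsStable f u := by
  rintro ⟨u, hweak, ⟨M₀, hM₀⟩, hu, hstab⟩
  lift q₀ to ℝ using ⟨hq₀'.ne, (EReal.bot_lt_zero.trans hq₀).ne'⟩ with r
  have hr : 0 < r := by exact_mod_cast hq₀
  have hC2 : ∀ t, 0 < t → ContDiffAt ℝ 2 f t := fun t ht => hf.contDiffAt (Ici_mem_nhds ht)
  have hC1 : ∀ t, 0 < t → ContDiffAt ℝ 1 f t := fun t ht => (hC2 t ht).of_le (by norm_num)
  have hC1' : ∀ t, 0 < t → ContDiffAt ℝ 1 (deriv f) t := fun t ht =>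
    (hC2 t ht).derivWithin (by norm_num)
  have hd : ∀ t, 0 < t → HasDerivAt f (deriv f t) t := fun t ht =>
    ((hC1 t ht).differentiableAt one_ne_zero).hasDerivAt
  have hdd : ∀ t, 0 < t → HasDerivAt (deriv f) (deriv (deriv f) t) t := fun t ht =>
    ((hC1' t ht).differentiableAt one_ne_zero).hasDerivAt
  have hmono' : MonotoneOn (deriv f) (Set.Ioi 0) :=
    (hconv.subset Set.Ioi_subset_Ici_self (convex_Ioi 0)).monotoneOn_deriv
      fun t ht => (hd t ht).differentiableAt
  have hd0 : ∀ t, 0 < t → 0 ≤ deriv f t := fun t ht => by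
    rw [← derivWithin_of_mem_nhds (Ici_mem_nhds ht)]
    exact hmono.derivWithin_nonneg
  have hdd0 : ∀ t, 0 < t → 0 ≤ deriv (deriv f) t := fun t ht => by
    rw [← derivWithin_of_mem_nhds (Ioi_mem_nhds ht)]
    exact hmono'.derivWithin_nonneg
  -- Positivity of `q₀` gives `f'² ≥ (r / 2) f f'' > 0` near `0`, and `f'` is nondecreasing.
  have hf' : ∀ t, 0 < t → 0 < deriv f t := fun t ht => by
    obtain ⟨ε, hε, h⟩ :=
      exists_forall_le_of_tendsto_q hlim hpos hdd0 (half_lt_self hr) (lt_add_one r)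
    have ht' : 0 < min t ε := lt_min ht hε
    obtain ⟨h1, h2, -⟩ := h _ ht' (min_le_right _ _)
    have h3 : 0 < deriv f (min t ε) ^ 2 :=
      (mul_pos (half_pos hr) (mul_pos (hpos _ ht') h1)).trans_le h2
    exact (lt_of_le_of_ne (hd0 _ ht') fun h => by simp [← h] at h3).trans_le
      (hmono' ht' ht (min_le_left _ _))
  have hcontu : Continuous u := hweak.1.continuous
  have hfc' : Continuous fun x => deriv f (u x) := continuous_iff_continuousAt.2 fun x =>
    ContinuousAt.comp (f := u) (hC1' _ (hu x)).continuousAt hcontu.continuousAt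
  have hint : ∀ (g : Space N → ℝ), Continuous g → ∀ η : Space N → ℝ, Continuous η →
      HasCompactSupport η → Integrable (fun x => g x * η x ^ 2) volume := fun g hg η hη hηc =>
    (hg.mul (hη.pow 2)).integrable_of_hasCompactSupport
      (hηc.comp_left (g := fun t : ℝ => t ^ 2) (zero_pow two_ne_zero)).mul_left
  set M := max M₀ 1
  have hM : ∀ x, u x ≤ M := fun x => (le_abs_self _).trans ((hM₀ x).trans (le_max_left _ _))
  have hf0 : 0 ≤ f 0 := by
    have h1 : Tendsto f (𝓝[>] 0) (𝓝 (f 0)) :=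
      ((hf.continuousOn 0 Set.self_mem_Ici).mono Set.Ioi_subset_Ici_self).tendsto
    refine ge_of_tendsto h1 ?_
    filter_upwards [self_mem_nhdsWithin] with t ht using (hpos t ht).le
  rcases hf0.lt_or_eq with hf0 | hf0
  · obtain ⟨ε, hε, h⟩ :=
      exists_forall_le_of_tendsto_q hlim hpos hdd0 (half_lt_self hr) (lt_add_one r)
    obtain ⟨c, hc, hcf⟩ := exists_rpow_le_deriv (M := M) hpos hd hdd hf' hmono' (half_pos hr) hε
      fun t ht hte => (h t ht hte).2.1
    set c' := c * f 0 ^ (1 / (r / 2))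
    have hc' : 0 < c' := mul_pos hc (Real.rpow_pos_of_pos hf0 _)
    have hcu : ∀ x, c' ≤ deriv f (u x) := fun x =>
      (mul_le_mul_of_nonneg_left (Real.rpow_le_rpow hf0.le
        (hmono Set.self_mem_Ici (hu x).le (hu x).le) (by positivity)) hc.le).trans
        (hcf _ (hu x) (hM x))
    -- For constant `w` the exponent `p` is free; with `s = 1` this choice satisfies `N < 2 (N +
    -- 2)`.
    refine not_caccioppoli (N := N) (w := fun _ => 1) (p := N + 1) (s := 1) (C := 1 / c')
      continuous_const (fun _ => one_pos) (by positivity) one_pos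
      (by linarith [N.cast_nonneg (α := ℝ)]) ?_
    rintro η ⟨K, hK⟩ hηc
    have h1 := hstab.integral_le hfc' hK hηc
    have h2 : ∫ x, c' * η x ^ 2 ≤ ∫ x, deriv f (u x) * η x ^ 2 :=
      integral_mono (hint _ continuous_const η hK.continuous hηc)
        (hint _ hfc' η hK.continuous hηc)
        fun x => mul_le_mul_of_nonneg_right (hcu x) (sq_nonneg _)
    rw [integral_const_mul] at h2
    simp only [Real.one_rpow, one_mul]
    rw [one_div, ← div_eq_inv_mul, le_div_iff₀ hc']
    linarith
  · have hr1 : 1 ≤ r := by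
      by_contra! hlt
      obtain ⟨ε, hε, h⟩ :=
        exists_forall_le_of_tendsto_q hlim hpos hdd0 (half_lt_self hr) hlt
      exact not_deriv_sq_le hf0.symm hconv hpos hd hdd hf' hε fun t ht hte => by
        simpa using (h t ht hte).2.2
    obtain ⟨a, q₁, q₂, ha, hq₁, hq₁r, hrq₂, hD, haq⟩ :=
      exists_exponents hr1 (dimension_lt hr1 hN)
    obtain ⟨ε₀, hε₀, h⟩ := exists_forall_le_of_tendsto_q hlim hpos hdd0 hq₁r hrq₂
    -- Only countably many level sets of `u` have positive measure, while the interval is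
    -- uncountable.
    obtain ⟨ε, ⟨hε, hεlt⟩, hεu⟩ : ∃ ε ∈ Set.Ioo 0 (min ε₀ 1), ∀ᵐ x, u x ≠ ε := by
      have hcount := Measure.countable_meas_level_set_pos (μ := (volume : Measure (Space N)))
        hcontu.measurable
      obtain ⟨ε, hεI, hε⟩ := Set.not_subset.1
        fun hsub : Set.Ioo 0 (min ε₀ 1) ⊆ {t | 0 < volume {x | u x = t}} =>
        (lt_min hε₀ one_pos).not_ge (Cardinal.Real.Ioo_countable_iff.1 (hcount.mono hsub))
      refine ⟨ε, hεI, ?_⟩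
      simpa [ae_iff] using hε
    have hεε₀ : ε ≤ ε₀ := hεlt.le.trans (min_le_left _ _)
    have hεM : ε ≤ M := hεlt.le.trans ((min_le_right _ _).trans (le_max_right _ _))
    obtain ⟨c, hc, hcf⟩ := exists_rpow_le_deriv (M := M) hpos hd hdd hf' hmono' hq₁ hε₀
      fun t ht hte => (h t ht hte).2.1
    obtain ⟨φ, C, hφc, hφpos, hφle, hC⟩ := exists_energy_estimate_rpow hweak hstab hu hM hε hεM
      hεu hC1 hC1' hpos hf' hdd0 hmono' ha (hr.trans hrq₂) haq
      fun t ht hte => (h t ht (hte.trans hεε₀)).2.2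
    have hw : Continuous fun x => φ (u x) := hφc.comp_continuous hcontu hu
    have ha0 : 0 < a := by linarith
    -- Chosen so that `(f^a)^s = f^(1/q₁)`; then `2 (2 + s) / s = 4 a q₁ + 2`.
    set s := 1 / (a * q₁) with hs
    have hs0 : 0 < s := by positivity
    have hdim : (N : ℝ) < 2 * ((2 + s) / s) := by
      have : (2 + s) / s = 2 * (a * q₁) + 1 := by
        rw [hs]
        field_simp
      linarith
    have hlow : ∀ x, c * φ (u x) ^ (2 + s) ≤ deriv f (u x) * φ (u x) ^ 2 := fun x => by
      have h1 : φ (u x) ^ s ≤ f (u x) ^ (1 / q₁) := by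
        refine (Real.rpow_le_rpow (hφpos _ (hu x)).le (hφle _ (hu x)) hs0.le).trans (le_of_eq ?_)
        rw [← Real.rpow_mul (hpos _ (hu x)).le, hs]
        congr 1
        field_simp
      have h2 := (mul_le_mul_of_nonneg_left h1 hc.le).trans (hcf _ (hu x) (hM x))
      rw [add_comm, Real.rpow_add (hφpos _ (hu x)), Real.rpow_two, ← mul_assoc]
      exact mul_le_mul_of_nonneg_right h2 (sq_nonneg _)
    refine not_caccioppoli (C := C / c) hw (fun x => hφpos _ (hu x)) two_pos hs0 hdim ?_
    intro η hηL hηc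
    have h1 := hC η hηL hηc
    have hηcont : Continuous η := hηL.choose_spec.continuous
    have h2 : ∫ x, c * φ (u x) ^ (2 + s) * η x ^ 2 ≤
        ∫ x, deriv f (u x) * φ (u x) ^ 2 * η x ^ 2 :=
      integral_mono (hint _ (continuous_const.mul
          (hw.rpow_const fun x => Or.inl (hφpos _ (hu x)).ne')) η hηcont hηc)
        (hint _ (hfc'.mul (hw.pow 2)) η hηcont hηc)
        fun x => mul_le_mul_of_nonneg_right (hlow x) (sq_nonneg _)
    simp_rw [mul_assoc c] at h2
    rw [integral_const_mul] at h2
    simp only [Real.rpow_two]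
    rw [div_mul_eq_mul_div, le_div_iff₀ hc]
    linarith

end StableLiouville

theorem theorem3p1 (f : ℝ → ℝ)
    (hf : ContDiffOn ℝ 2 f (Set.Ici 0))
    (hmono : MonotoneOn f (Set.Ici 0))
    (hconv : ConvexOn ℝ (Set.Ici 0) f)
    (hpos : ∀ t : ℝ, 0 < t → 0 < f t)
    (q₀ : EReal)
    (hlim : Tendsto (StableLiouville.q f) (𝓝[>] (0 : ℝ)) (𝓝 q₀))
    (hq₀ : 0 < q₀) (hq₀' : q₀ < ⊤)
    (N : ℕ)
    (hN : (1 ≤ N ∧ N ≤ 9) ∨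
      (N = 10 ∧ StableLiouville.conjExponent q₀ < ⊤) ∨
      (11 ≤ N ∧ StableLiouville.conjExponent q₀ < (StableLiouville.pc N : EReal))) :
    (¬ ∃ u : StableLiouville.Space N → ℝ,
      StableLiouville.IsClassicalSubsolution f u ∧ (∃ M : ℝ, ∀ x, |u x| ≤ M) ∧
        (∀ x, 0 < u x) ∧ StableLiouville.IsStable f u) ∧
    (¬ ∃ u : StableLiouville.Space N → ℝ,
      StableLiouville.IsWeakSubsolution f u ∧ (∃ M : ℝ, ∀ x, |u x| ≤ M) ∧
        (∀ x, 0 < u x) ∧ StableLiouville.IsStable f u) := by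
  have hweak := StableLiouville.not_exists_stable_weakSubsolution f hf hmono hconv hpos q₀ hlim
    hq₀ hq₀' N hN
  refine ⟨?_, hweak⟩
  rintro ⟨u, hsub, hbdd, hu, hstab⟩
  exact hweak ⟨u, hsub.isWeakSubsolution (hf.continuousOn.comp_continuous hsub.1.continuous
    fun x => (hu x).le), hbdd, hu, hstab⟩
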